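/- Let $N,m,n\ge 1$ be integers. Let $\mathcal G$ be a weighted undirected graph on the nodes $1,\dots,N$ with adjacency weights $a_{ij}=a_{ji}\ge 0$, $a_{ii}=0$, where $i$ and $j$ are joined by an edge if and only if $a_{ij}>0$, and suppose that $\mathcal G$ is connected. For $i=1,\dots,N$ let $f_i\colon\mathbb R^m\to\mathbb R$ be differentiable and strictly convex, and suppose that $y^*\in\mathbb R^m$ minimizes $f(y)=\sum_{i=1}^N f_i(y)$ over $\mathbb R^m$. Let $c_0,\dots,c_{n-1}\in\mathbb R$ be such that the polynomial $s^n+\sum_{k=0}^{n-1}c_ks^k$ is Hurwitz, i.e. all its complex roots have negative real part, and let $\varepsilon>0$ be arbitrary. Consider the agents $x_i^{(n)}=v_i$ with outputs $y_i=x_i\in\mathbb R^m$, $i=1,\dots,N$, under the control $$ \begin{cases} v_i=-\dfrac1{\varepsilon^n}\Bigl[c_0(x_i-z_i)+\sum_{k=1}^{n-1}\varepsilon^kc_kx_i^{(k)}\Bigr],\\[1ex] \dot z_i=-\nabla f_i(z_i)-\sum_{j=1}^Na_{ij}(\lambda_i-\lambda_j),\\[1ex] \dot\lambda_i=\sum_{j=1}^Na_{ij}(z_i-z_j),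 \end{cases} $$ with $z_i,\lambda_i\in\mathbb R^m$. Then: (a) For all initial values $x_i^{(k)}(0)$ $(0\le k<n)$, $z_i(0)$, $\lambda_i(0)$ in $\mathbb R^m$, $1\le i\le N$, the closed-loop system has a trajectory on $[0,\infty)$. (b) Along every trajectory on $[0,\infty)$, all of $x_i,x_i^{(1)},\dots,x_i^{(n-1)},z_i,\lambda_i$ are bounded, and $\lim_{t\to+\infty}\|y_i(t)-y^*\|=0$ for $i=1,\dots,N$. (c) If, moreover, there are constants $\omega,\vartheta>0$ such that for every $i$ and all $p,q\in\mathbb R^m$ $$(\nabla f_i(p)-\nabla f_i(q))^\top(p-q)\ge\omega\|p-q\|^2,\qquad \|\nabla f_i(p)-\nabla f_i(q)\|\le\vartheta\|p-q\|,$$ then every $y_i(t)$ converges to $y^*$ exponentially: there is $\gamma>0$, not depending on the trajectory, such that for every trajectory on $[0,\infty)$ there is a constant $K$ with $\|y_i(t)-y^*\|\le Ke^{-\gamma t}$ for all $t\ge0$ and $i=1,\dots,N$. -/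

import Mathlib

open Set Filter Topology
open scoped NNReal

noncomputable section

namespace OptConsensus

/-- A weighted undirected graph on the nodes `Fin N`, without self-loops, given by its
weighted adjacency matrix. -/
structure WeightedGraph (N : ℕ) where
  a : Matrix (Fin N) (Fin N) ℝ
  symm : ∀ i j, a i j = a j i
  nonneg : ∀ i j, 0 ≤ a i j
  diag : ∀ i, a i i = 0

/-- The underlying simple graph: `i` and `j` are joined by an edge iff `a i j > 0`. -/
def WeightedGraph.toSimpleGraph {N : ℕ} (G : WeightedGraph N) : SimpleGraph (Fin N) where
  Adj i j := 0 < G.a i j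
  symm := ⟨fun i j h => by rw [G.symm j i]; exact h⟩
  loopless := ⟨fun i h => by rw [G.diag i] at h; exact lt_irrefl _ h⟩

/-- A real polynomial is Hurwitz if all its complex roots have negative real part. -/
def IsHurwitz (p : Polynomial ℝ) : Prop :=
  ∀ s : ℂ, Polynomial.aeval s p = 0 → s.re < 0

/-- The monic polynomial `c 0 + c 1 * s + ⋯ + c (n-1) * s ^ (n-1) + s ^ n`. -/
def charPoly (n : ℕ) (c : ℕ → ℝ) : Polynomial ℝ :=
  (∑ k ∈ Finset.range n, Polynomial.C (c k) * Polynomial.X ^ k) + Polynomial.X ^ n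

/-- `ω`-strong convexity of a differentiable function, in terms of its gradient. -/
def IsStronglyConvex {m : ℕ} (ω : ℝ) (f : EuclideanSpace ℝ (Fin m) → ℝ) : Prop :=
  ∀ p q : EuclideanSpace ℝ (Fin m),
    ω * ‖p - q‖ ^ 2 ≤ inner ℝ (gradient f p - gradient f q) (p - q)

/-- The `k`-th time derivative of a curve defined on `[0, ∞)` (one-sided at `t = 0`). -/
def timeDeriv {m : ℕ} (k : ℕ) (x : ℝ → EuclideanSpace ℝ (Fin m)) (t : ℝ) :
    EuclideanSpace ℝ (Fin m) :=
  iteratedDerivWithin k x (Ici 0) t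

/-- The high-gain tracking law
`-(1 / ε ^ n) * (c 0 * (x - z) + ∑_{k = 1}^{n - 1} ε ^ k * c k * x^(k))` at time `t`. -/
def trackingLaw {m : ℕ} (n : ℕ) (c : ℕ → ℝ) (ε : ℝ) (x z : ℝ → EuclideanSpace ℝ (Fin m))
    (t : ℝ) : EuclideanSpace ℝ (Fin m) :=
  -(1 / ε ^ n) • (c 0 • (x t - z t) + ∑ k ∈ Finset.Ico 1 n, (ε ^ k * c k) • timeDeriv k x t)

/-- `(x, z, l)` is a trajectory on `[0, ∞)` of the agents `x_i^(n) = v_i` in closed loop with the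
tracking law and the primal-dual generator; `l i` is the dual variable of agent `i`. -/
structure IsClosedLoopTrajectory {N m : ℕ} (n : ℕ) (G : WeightedGraph N)
    (f : Fin N → EuclideanSpace ℝ (Fin m) → ℝ) (c : ℕ → ℝ) (ε : ℝ)
    (x z l : Fin N → ℝ → EuclideanSpace ℝ (Fin m)) : Prop where
  contDiffOn : ∀ i, ContDiffOn ℝ n (x i) (Ici 0)
  agent : ∀ i, ∀ t, 0 ≤ t → timeDeriv n (x i) t = trackingLaw n c ε (x i) (z i) t
  primal : ∀ i, ∀ t, 0 ≤ t → HasDerivWithinAt (z i)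
    (-gradient (f i) (z i t) - ∑ j, G.a i j • (l i t - l j t)) (Ici 0) t
  dual : ∀ i, ∀ t, 0 ≤ t → HasDerivWithinAt (l i)
    (∑ j, G.a i j • (z i t - z j t)) (Ici 0) t

end OptConsensus

end

namespace OptConsensus

/-! ### Gradients of convex functions -/

section ConvexGradient

variable {E : Type*} [NormedAddCommGroup E] [InnerProductSpace ℝ E] [CompleteSpace E]

/-! The closed loop is a cascade: the generator `(z, l)` does not see `x`, and each coordinate of
each `x i` solves a scalar linear equation driven by `z i`.

Stacking the agents, the generator reads `z' = -F z - L l`, `l' = L z`, with `F` the field of local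
gradients and `L` the Laplacian. Connectedness makes `ker L` the consensus space. Since the
gradients sum to zero at the minimizer, `F p` at the consensus point `p` is orthogonal to `ker L`,
hence lies in `range L`, and some `q` satisfies `F p + L q = 0` (`exists_dual_optimum`). The skew
coupling drops out of the derivative of `‖z - p‖ ^ 2 + ‖l - q‖ ^ 2`, which is `-2 ⟪F z - F p, z -
p⟫`. This bounds all trajectories, and strict monotonicity gives `z → p` by a Barbalat argument
(`tendsto_of_lyapunov`).

Gradients of convex functions are continuous but need not be locally Lipschitz, so existence comes
from monotonicity: Euler polygons with vanishing step form a Cauchy sequence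
(`exists_hasDerivWithinAt_of_monotone`).

In the strongly convex case, a small cross term between `z - p` and `L (l - q)` supplies the missing
dissipation in the dual variable (`exists_rate_primalDual`).

For the tracking loop, the Hurwitz polynomial is factored over `ℂ`, so boundedness, convergence and
exponential decay need checking only for a first-order equation; `cascade_mem` then passes them from
`z` to `x` and its derivatives. -/

theorem add_inner_gradient_le {f : E → ℝ} (hf : ConvexOn ℝ univ f) (hd : Differentiable ℝ f)
    (x y : E) : f x + inner ℝ (gradient f x) (y - x) ≤ f y := by
  have hg : ConvexOn ℝ univ (f ∘ AffineMap.lineMap (k := ℝ) x y) := by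
    simpa using hf.comp_affineMap (AffineMap.lineMap (k := ℝ) x y)
  have hder : HasDerivAt (f ∘ AffineMap.lineMap (k := ℝ) x y)
      (inner ℝ (gradient f x) (y - x)) 0 := by
    have h1 : HasFDerivAt f (InnerProductSpace.toDual ℝ E (gradient f x))
        (AffineMap.lineMap (k := ℝ) x y (0 : ℝ)) := by
      simpa using (hd x).hasGradientAt.hasFDerivAt
    simpa using h1.comp_hasDerivAt (0 : ℝ) (AffineMap.hasDerivAt_lineMap (x := (0 : ℝ)))
  have := hg.le_slope_of_hasDerivAt (mem_univ _) (mem_univ _) zero_lt_one hder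
  rw [slope_def_field] at this
  simp only [Function.comp_apply, AffineMap.lineMap_apply_one, AffineMap.lineMap_apply_zero, sub_zero,
    div_one] at this
  linarith

/-- The gradient inequality at the midpoint, combined with strict convexity there, leaves a strict
gap at `y`. -/
theorem add_inner_gradient_lt {f : E → ℝ} (hf : StrictConvexOn ℝ univ f)
    (hd : Differentiable ℝ f) {x y : E} (hxy : x ≠ y) :
    f x + inner ℝ (gradient f x) (y - x) < f y := by
  have h1 := add_inner_gradient_le hf.convexOn hd x ((1 / 2 : ℝ) • x + (1 / 2 : ℝ) • y)
  have h2 := hf.2 (mem_univ x) (mem_univ y) hxy (by norm_num : (0 : ℝ) < 1 / 2)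
    (by norm_num : (0 : ℝ) < 1 / 2) (by norm_num)
  have h3 : (1 / 2 : ℝ) • x + (1 / 2 : ℝ) • y - x = (1 / 2 : ℝ) • (y - x) := by module
  rw [h3, inner_smul_right] at h1
  simp only [smul_eq_mul] at h2
  linarith

theorem inner_gradient_sub_nonneg {f : E → ℝ} (hf : ConvexOn ℝ univ f)
    (hd : Differentiable ℝ f) (x y : E) :
    0 ≤ inner ℝ (gradient f x - gradient f y) (x - y) := by
  have h1 := add_inner_gradient_le hf hd x y
  have h2 := add_inner_gradient_le hf hd y x
  rw [← neg_sub x y, inner_neg_right] at h1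
  rw [inner_sub_left]
  linarith

theorem inner_gradient_sub_pos {f : E → ℝ} (hf : StrictConvexOn ℝ univ f)
    (hd : Differentiable ℝ f) {x y : E} (hxy : x ≠ y) :
    0 < inner ℝ (gradient f x - gradient f y) (x - y) := by
  have h1 := add_inner_gradient_lt hf hd hxy
  have h2 := add_inner_gradient_lt hf hd hxy.symm
  rw [← neg_sub x y, inner_neg_right] at h1
  rw [inner_sub_left]
  linarith

/-- The gradient of a differentiable convex function is continuous. -/
theorem continuous_gradient_of_convexOn {f : E → ℝ} (hf : ConvexOn ℝ univ f)
    (hd : Differentiable ℝ f) : Continuous (gradient f) := by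
  rw [continuous_iff_continuousAt]
  intro x
  rw [Metric.continuousAt_iff]
  intro η hη
  have ho := (hasGradientAt_iff_isLittleO.1 (hd x).hasGradientAt).def
    (by positivity : 0 < η / 6)
  obtain ⟨δ, hδ, hδo⟩ := Metric.eventually_nhds_iff.1 ho
  refine ⟨δ / 4, by positivity, fun {y} hy => ?_⟩
  set d := gradient f y - gradient f x with hdd
  rw [dist_eq_norm]
  by_cases hd0 : d = 0
  · rw [← hdd, hd0, norm_zero]; exact hη
  have hdn : 0 < ‖d‖ := norm_pos_iff.2 hd0
  set t := δ / 4 with ht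
  have htp : 0 < t := by positivity
  -- Probing in the direction of the gradient difference `d` turns `⟪d, v⟫` into `t * ‖d‖`. The
  -- first-order errors at `y` and `y + v` are at most `η / 6` times `t` and `2 * t`, whence `‖d‖ ≤
  -- η / 2`.
  set v := (t / ‖d‖) • d with hv
  have hvn : ‖v‖ = t := by
    rw [hv, norm_smul, Real.norm_of_nonneg (by positivity)]; field_simp
  rw [dist_eq_norm] at hy
  have hyv : ‖y + v - x‖ ≤ 2 * t := by
    calc ‖y + v - x‖ = ‖(y - x) + v‖ := by congr 1; abel
      _ ≤ ‖y - x‖ + ‖v‖ := norm_add_le _ _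
      _ ≤ 2 * t := by linarith
  have e1 := hδo (y := y) (by rw [dist_eq_norm]; linarith)
  have e2 := hδo (y := y + v) (by rw [dist_eq_norm]; linarith)
  have e3 := add_inner_gradient_le hf hd y (y + v)
  rw [add_sub_cancel_left] at e3
  have hin : inner ℝ d v = t * ‖d‖ := by
    rw [hv, inner_smul_right, real_inner_self_eq_norm_sq]; field_simp
  have hsplit : inner ℝ (gradient f x) (y + v - x)
      = inner ℝ (gradient f x) (y - x) + inner ℝ (gradient f x) v := by
    rw [← inner_add_right]; congr 1; abel
  rw [Real.norm_eq_abs, abs_le] at e1 e2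
  rw [hsplit] at e2
  have hd' : inner ℝ d v = inner ℝ (gradient f y) v - inner ℝ (gradient f x) v := by
    rw [hdd, inner_sub_left]
  have key : t * ‖d‖ ≤ η / 6 * (3 * t) := by
    have : η / 6 * ‖y - x‖ ≤ η / 6 * t := by gcongr
    have : η / 6 * ‖y + v - x‖ ≤ η / 6 * (2 * t) := by gcongr
    linarith [e1.1, e2.2]
  have : ‖d‖ ≤ η / 2 := by
    by_contra! h
    nlinarith
  linarith

end ConvexGradient

/-! ### Comparison lemmas for curves on a half-line -/

section HalfLine

theorem _root_.HasDerivWithinAt.Ici_of_Ici {E : Type*} [NormedAddCommGroup E] [NormedSpace ℝ E]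
    {u : ℝ → E} {u' : E} {a t : ℝ} (h : HasDerivWithinAt u u' (Ici a) t) (hat : a ≤ t) :
    HasDerivWithinAt u u' (Ici t) t :=
  h.mono (Ici_subset_Ici.2 hat)

/-- A function on `[a, ∞)` whose derivative is at most `C` grows at most linearly. -/
theorem le_add_mul_of_hasDerivWithinAt_le {φ φ' : ℝ → ℝ} {a b C : ℝ} (hab : a ≤ b)
    (hc : ContinuousOn φ (Icc a b))
    (h : ∀ t ∈ Ico a b, HasDerivWithinAt φ (φ' t) (Ici t) t) (hC : ∀ t ∈ Ico a b, φ' t ≤ C) :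
    φ b ≤ φ a + C * (b - a) := by
  have hB : ∀ t, HasDerivAt (fun t => φ a + C * (t - a)) C t := fun t => by
    simpa using (((hasDerivAt_id t).sub_const a).const_mul C).const_add (φ a)
  exact image_le_of_deriv_right_le_deriv_boundary (B := fun t => φ a + C * (t - a))
    (B' := fun _ => C) hc h (by simp)
    (fun t _ => (hB t).continuousAt.continuousWithinAt)
    (fun t _ => (hB t).hasDerivWithinAt) hC (right_mem_Icc.2 hab)

theorem antitoneOn_Ici_of_hasDerivWithinAt_nonpos {φ φ' : ℝ → ℝ}
    (h : ∀ t, 0 ≤ t → HasDerivWithinAt φ (φ' t) (Ici 0) t) (hn : ∀ t, 0 ≤ t → φ' t ≤ 0) :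
    AntitoneOn φ (Ici 0) := by
  intro s hs t _ hst
  have hs : 0 ≤ s := hs
  have := le_add_mul_of_hasDerivWithinAt_le (C := 0) (φ' := φ') hst
    (fun r hr => ((h r (hs.trans hr.1)).mono (fun q hq => hs.trans hq.1)).continuousWithinAt)
    (fun r hr => (h r (hs.trans hr.1)).Ici_of_Ici (hs.trans hr.1))
    (fun r hr => hn r (hs.trans hr.1))
  linarith

/-- If `φ' ≤ -κ φ` then `φ` decays at the rate `κ`. -/
theorem le_mul_exp_of_hasDerivWithinAt_le {φ φ' : ℝ → ℝ} {κ : ℝ}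
    (h : ∀ t, 0 ≤ t → HasDerivWithinAt φ (φ' t) (Ici 0) t)
    (hn : ∀ t, 0 ≤ t → φ' t ≤ -κ * φ t) {t : ℝ} (ht : 0 ≤ t) :
    φ t ≤ φ 0 * Real.exp (-κ * t) := by
  have hE : ∀ t : ℝ, HasDerivAt (fun t => Real.exp (κ * t)) (Real.exp (κ * t) * κ) t := fun t => by
    simpa using ((hasDerivAt_id t).const_mul κ).exp
  have := antitoneOn_Ici_of_hasDerivWithinAt_nonpos
    (fun t ht => (h t ht).mul (hE t).hasDerivWithinAt)
    (fun t ht => by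
      have := hn t ht
      have : φ' t * Real.exp (κ * t) ≤ -κ * φ t * Real.exp (κ * t) := by gcongr
      linarith) self_mem_Ici ht ht
  simp only [Pi.mul_apply, mul_zero, Real.exp_zero, mul_one] at this
  calc φ t = φ t * Real.exp (κ * t) * Real.exp (-κ * t) := by
        rw [mul_assoc, ← Real.exp_add]; simp
    _ ≤ _ := by gcongr

/-- A Barbalat-type lemma: if a Lipschitz curve `z` stays in a compact ball, a function `V ≥ 0`
has the derivative `-W (z t)`, and `W` is continuous and positive away from `p`, then `z` tends
to `p`. -/
theorem tendsto_of_lyapunov {E : Type*} [NormedAddCommGroup E] [NormedSpace ℝ E] [ProperSpace E]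
    {V : ℝ → ℝ} {W : E → ℝ} {z : ℝ → E} {p : E} {R M : ℝ}
    (hV0 : ∀ t, 0 ≤ t → 0 ≤ V t)
    (hV : ∀ t, 0 ≤ t → HasDerivWithinAt V (-W (z t)) (Ici 0) t)
    (hWc : Continuous W) (hW0 : ∀ q, 0 ≤ W q) (hW : ∀ q, q ≠ p → 0 < W q)
    (hR : ∀ t, 0 ≤ t → ‖z t - p‖ ≤ R)
    (hM : ∀ s t, 0 ≤ s → s ≤ t → ‖z t - z s‖ ≤ M * (t - s)) :
    Tendsto z atTop (𝓝 p) := by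
  have hanti := antitoneOn_Ici_of_hasDerivWithinAt_nonpos hV (fun t _ => by simpa using hW0 (z t))
  have hlim : ∃ L, Tendsto V atTop (𝓝 L) := by
    have h1 : Antitone (fun t => V (max t 0)) := fun s t hst =>
      hanti (mem_Ici.2 (le_max_right _ _)) (mem_Ici.2 (le_max_right _ _)) (max_le_max_right 0 hst)
    have h2 : BddBelow (range fun t => V (max t 0)) :=
      ⟨0, by rintro _ ⟨t, rfl⟩; exact hV0 _ (le_max_right _ _)⟩
    refine ⟨_, (tendsto_atTop_ciInf h1 h2).congr' ?_⟩
    filter_upwards [eventually_ge_atTop 0] with t ht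
    rw [max_eq_left ht]
  obtain ⟨L, hL⟩ := hlim
  rw [Metric.tendsto_atTop]
  intro δ hδ
  by_contra! hcon
  have hM0 : 0 ≤ M := by
    have := hM 0 1 le_rfl zero_le_one
    simp only [sub_zero, mul_one] at this
    exact (norm_nonneg _).trans this
  -- A curve of speed at most `M` that is `δ` away from `p` stays `δ / 2` away for this long; `M +
  -- 1` avoids dividing by zero. During that time `V` drops by a fixed amount, which cannot recur at
  -- arbitrarily late times because `V` converges.
  set τ := δ / (2 * (M + 1)) with hτ
  have hτp : 0 < τ := by positivity
  have hMτ : M * τ ≤ δ / 2 := by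
    rw [hτ]; field_simp; linarith
  set K := {q : E | δ / 2 ≤ ‖q - p‖} ∩ Metric.closedBall p R with hK
  have hKc : IsCompact K :=
    (isCompact_closedBall p R).inter_left (isClosed_le continuous_const (by fun_prop))
  have hη : ∃ η, 0 < η ∧ ∀ q ∈ K, η ≤ W q := by
    rcases K.eq_empty_or_nonempty with hKe | hKn
    · exact ⟨1, one_pos, by simp [hKe]⟩
    · obtain ⟨q, hq, hqm⟩ := hKc.exists_isMinOn hKn hWc.continuousOn
      refine ⟨W q, hW q ?_, fun r hr => hqm hr⟩
      rintro rfl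
      have : δ / 2 ≤ ‖q - q‖ := hq.1
      simp at this
      linarith
  obtain ⟨η, hηp, hηK⟩ := hη
  have hdiff : Tendsto (fun t => V t - V (t + τ)) atTop (𝓝 0) := by
    simpa using hL.sub (hL.comp (tendsto_atTop_add_const_right _ τ tendsto_id))
  have hev : ∀ᶠ t in atTop, V t - V (t + τ) < η * τ :=
    hdiff.eventually (gt_mem_nhds (by positivity))
  obtain ⟨T, hT⟩ := eventually_atTop.1 (hev.and (eventually_ge_atTop 0))
  obtain ⟨t, htT, htδ⟩ := hcon T
  obtain ⟨h1, ht0⟩ := hT t htT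
  have := le_add_mul_of_hasDerivWithinAt_le (φ := V) (a := t) (b := t + τ) (C := -η)
    (φ' := fun r => -W (z r)) (by linarith)
    (fun r hr => ((hV r (ht0.trans hr.1)).mono (fun q hq => ht0.trans hq.1)).continuousWithinAt)
    (fun r hr => (hV r (ht0.trans hr.1)).Ici_of_Ici (ht0.trans hr.1))
    (fun r hr => by
      refine neg_le_neg (hηK _ ⟨?_, ?_⟩)
      · have h2 := hM t r ht0 hr.1
        have h3 : M * (r - t) ≤ M * τ := by
          have := hr.2
          gcongr; linarith
        rw [dist_eq_norm] at htδ
        have h4 : ‖z t - p‖ ≤ ‖z r - p‖ + ‖z r - z t‖ := by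
          have : z t - p = (z r - p) - (z r - z t) := by abel
          rw [this]; exact norm_sub_le _ _
        show δ / 2 ≤ ‖z r - p‖
        linarith
      · rw [mem_closedBall_iff_norm]; exact hR r (ht0.trans hr.1))
  nlinarith

end HalfLine

/-! ### Evolution equations governed by continuous monotone fields -/

section Monotone

variable {V : Type*} [NormedAddCommGroup V] [InnerProductSpace ℝ V]

/-- The retraction of the space onto the ball of radius `R` around `p`. -/
noncomputable def ballRetraction (p : V) (R : ℝ) (v : V) : V :=
  p + (R / max R ‖v - p‖) • (v - p)

theorem ballRetraction_of_mem {p v : V} {R : ℝ} (hR : 0 < R) (hv : ‖v - p‖ ≤ R) :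
    ballRetraction p R v = v := by
  rw [ballRetraction, max_eq_left hv, div_self hR.ne', one_smul, add_sub_cancel]

theorem norm_ballRetraction_sub_le {p : V} {R : ℝ} (hR : 0 < R) (v : V) :
    ‖ballRetraction p R v - p‖ ≤ R := by
  have hm : 0 < max R ‖v - p‖ := lt_max_of_lt_left hR
  rw [ballRetraction, add_sub_cancel_left, norm_smul, Real.norm_of_nonneg (by positivity),
    div_mul_eq_mul_div, div_le_iff₀ hm]
  gcongr
  exact le_max_right _ _

theorem continuous_ballRetraction {p : V} {R : ℝ} (hR : 0 < R) :
    Continuous (ballRetraction p R) := by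
  unfold ballRetraction
  refine continuous_const.add (Continuous.smul (continuous_const.div (by fun_prop) fun v => ?_)
    (by fun_prop))
  exact (lt_max_of_lt_left hR).ne'

/-- The nodes of the explicit Euler scheme of `u' = -B u` with step `h`. -/
noncomputable def eulerNode (B : V → V) (h : ℝ) (u₀ : V) : ℕ → V
  | 0 => u₀
  | k + 1 => eulerNode B h u₀ k - h • B (eulerNode B h u₀ k)

/-- The step function through the Euler nodes. -/
noncomputable def eulerStep (B : V → V) (h : ℝ) (u₀ : V) (t : ℝ) : V := eulerNode B h u₀ ⌊t / h⌋₊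

/-- The Euler polygon. -/
noncomputable def eulerPolygon (B : V → V) (h : ℝ) (u₀ : V) (t : ℝ) : V :=
  u₀ - ∫ s in (0 : ℝ)..t, B (eulerStep B h u₀ s)

theorem stronglyMeasurable_comp_eulerStep (B : V → V) (h : ℝ) (u₀ : V) :
    MeasureTheory.StronglyMeasurable fun s => B (eulerStep B h u₀ s) := by
  have h1 : MeasureTheory.StronglyMeasurable fun k : ℕ => B (eulerNode B h u₀ k) :=
    MeasureTheory.StronglyMeasurable.of_discrete
  have h2 : Measurable fun s : ℝ => ⌊s / h⌋₊ := Nat.measurable_floor.comp (measurable_id.div_const h)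
  exact h1.comp_measurable h2

variable {B : V → V} {h M : ℝ} {u₀ : V}

theorem intervalIntegrable_comp_eulerStep (hM : ∀ v, ‖B v‖ ≤ M) (a b : ℝ) :
    IntervalIntegrable (fun s => B (eulerStep B h u₀ s)) MeasureTheory.volume a b :=
  (intervalIntegrable_const (c := M)).mono_fun
    (stronglyMeasurable_comp_eulerStep B h u₀).aestronglyMeasurable
    (Eventually.of_forall fun _ => (hM _).trans (le_abs_self M))

theorem eulerPolygon_sub (hM : ∀ v, ‖B v‖ ≤ M) (s t : ℝ) :
    eulerPolygon B h u₀ t - eulerPolygon B h u₀ s = -∫ r in s..t, B (eulerStep B h u₀ r) := by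
  rw [eulerPolygon, eulerPolygon, sub_sub_sub_cancel_left,
    intervalIntegral.integral_interval_sub_left (intervalIntegrable_comp_eulerStep hM _ _)
      (intervalIntegrable_comp_eulerStep hM _ _), intervalIntegral.integral_symm]

theorem norm_eulerPolygon_sub_le (hM : ∀ v, ‖B v‖ ≤ M) (s t : ℝ) :
    ‖eulerPolygon B h u₀ t - eulerPolygon B h u₀ s‖ ≤ M * |t - s| := by
  rw [eulerPolygon_sub hM, norm_neg]
  exact intervalIntegral.norm_integral_le_of_norm_le_const fun _ _ => hM _

theorem continuous_eulerPolygon (hM : ∀ v, ‖B v‖ ≤ M) : Continuous (eulerPolygon B h u₀) := by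
  have hM0 : 0 ≤ M := (norm_nonneg _).trans (hM u₀)
  exact (LipschitzWith.of_dist_le_mul (K := ⟨M, hM0⟩) fun s t => by
    rw [dist_eq_norm, dist_eq_norm]
    exact norm_eulerPolygon_sub_le hM t s).continuous

theorem floor_div_eq {k : ℕ} {s : ℝ} (hh : 0 < h) (h1 : k * h ≤ s) (h2 : s < (k + 1) * h) :
    ⌊s / h⌋₊ = k := by
  rw [Nat.floor_eq_iff (div_nonneg (le_trans (by positivity) h1) hh.le)]
  exact ⟨(le_div_iff₀ hh).2 h1, (div_lt_iff₀ hh).2 h2⟩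

variable [CompleteSpace V]

theorem eulerPolygon_mul (hM : ∀ v, ‖B v‖ ≤ M) (hh : 0 < h) (k : ℕ) :
    eulerPolygon B h u₀ (k * h) = eulerNode B h u₀ k := by
  induction k with
  | zero => simp [eulerPolygon, eulerNode]
  | succ k ih =>
    have h1 := eulerPolygon_sub (h := h) (u₀ := u₀) hM (k * h) ((k + 1 : ℕ) * h)
    have hle : (k : ℝ) * h ≤ (k + 1 : ℕ) * h := by push_cast; nlinarith
    rw [intervalIntegral.integral_congr_Ioo_of_le (g := fun _ => B (eulerNode B h u₀ k)) hle
      (fun s hs => by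
        simp only [eulerStep]
        rw [floor_div_eq hh hs.1.le (by simpa using hs.2)])] at h1
    rw [intervalIntegral.integral_const, ih, sub_eq_iff_eq_add] at h1
    rw [h1, eulerNode]
    have : ((k + 1 : ℕ) : ℝ) * h - k * h = h := by push_cast; ring
    rw [this]; abel

/-- The last node is less than `h` in the past and the polygon moves with speed at most `M`. -/
theorem norm_eulerPolygon_sub_eulerStep_le (hM : ∀ v, ‖B v‖ ≤ M) (hh : 0 < h) {t : ℝ}
    (ht : 0 ≤ t) : ‖eulerPolygon B h u₀ t - eulerStep B h u₀ t‖ ≤ M * h := by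
  have hM0 : 0 ≤ M := (norm_nonneg _).trans (hM u₀)
  rw [eulerStep, ← eulerPolygon_mul hM hh]
  refine (norm_eulerPolygon_sub_le hM _ _).trans ?_
  have h1 := (le_div_iff₀ hh).1 (Nat.floor_le (div_nonneg ht hh.le))
  have h2 := (div_lt_iff₀ hh).1 (Nat.lt_floor_add_one (t / h))
  gcongr
  rw [abs_of_nonneg (by linarith)]
  linarith

/-- The step function is right-continuous, so the polygon has a right derivative even at the nodes;
the comparison lemma needs no more. -/
theorem hasDerivWithinAt_eulerPolygon (hM : ∀ v, ‖B v‖ ≤ M) (hh : 0 < h) {t : ℝ}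
    (ht : 0 ≤ t) :
    HasDerivWithinAt (eulerPolygon B h u₀) (-B (eulerStep B h u₀ t)) (Ici t) t := by
  have h1 := (le_div_iff₀ hh).1 (Nat.floor_le (div_nonneg ht hh.le))
  have h2 := (div_lt_iff₀ hh).1 (Nat.lt_floor_add_one (t / h))
  have hev : ∀ᶠ s in 𝓝[≥] t, B (eulerStep B h u₀ s) = B (eulerStep B h u₀ t) := by
    filter_upwards [Ico_mem_nhdsGE h2] with s hs
    rw [eulerStep, floor_div_eq hh (h1.trans hs.1) hs.2, eulerStep]
  have hcont : ContinuousWithinAt (fun s => B (eulerStep B h u₀ s)) (Ici t) t :=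
    (continuousWithinAt_const (b := B (eulerStep B h u₀ t))).congr_of_eventuallyEq hev rfl
  have := intervalIntegral.integral_hasDerivWithinAt_right (a := 0)
    (intervalIntegrable_comp_eulerStep (h := h) (u₀ := u₀) hM 0 t) (s := Ici t) (t := Ioi t)
    ((stronglyMeasurable_comp_eulerStep B h u₀).stronglyMeasurableAtFilter)
    (hcont.mono Ioi_subset_Ici_self)
  exact this.const_sub u₀

/-- If `B` points away from `p`, the Euler polygons stay close to the ball around `p`. -/
theorem norm_eulerPolygon_sub_sq_le {p : V} (hM : ∀ v, ‖B v‖ ≤ M) (hh : 0 < h)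
    (hp : ∀ v, 0 ≤ inner ℝ (B v) (v - p)) {t : ℝ} (ht : 0 ≤ t) :
    ‖eulerPolygon B h u₀ t - p‖ ^ 2 ≤ ‖u₀ - p‖ ^ 2 + 2 * M ^ 2 * h * t := by
  have hM0 : 0 ≤ M := (norm_nonneg _).trans (hM u₀)
  have h0 : eulerPolygon B h u₀ 0 = u₀ := by simp [eulerPolygon]
  have := le_add_mul_of_hasDerivWithinAt_le (φ := fun t => ‖eulerPolygon B h u₀ t - p‖ ^ 2)
    (φ' := fun t => 2 * inner ℝ (eulerPolygon B h u₀ t - p) (-B (eulerStep B h u₀ t)))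
    (C := 2 * M ^ 2 * h) ht
    (((continuous_eulerPolygon hM).sub continuous_const).norm.pow 2).continuousOn
    (fun s hs => ((hasDerivWithinAt_eulerPolygon hM hh hs.1).sub_const p).norm_sq)
    (fun s hs => by
      have e1 := hp (eulerStep B h u₀ s)
      -- The field is evaluated at the node, not at the polygon. The node part has a sign by `hp`;
      -- the remainder is of order `h`.
      have e2 : inner ℝ (eulerPolygon B h u₀ s - p) (-B (eulerStep B h u₀ s))
          = -inner ℝ (B (eulerStep B h u₀ s)) (eulerStep B h u₀ s - p)
            - inner ℝ (B (eulerStep B h u₀ s)) (eulerPolygon B h u₀ s - eulerStep B h u₀ s) := by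
        rw [inner_neg_right, real_inner_comm, ← sub_add_sub_cancel _ (eulerStep B h u₀ s) p,
          inner_add_right]
        ring
      have e3 := (abs_le.1 (abs_real_inner_le_norm (B (eulerStep B h u₀ s))
        (eulerPolygon B h u₀ s - eulerStep B h u₀ s))).1
      have e4 : ‖B (eulerStep B h u₀ s)‖ * ‖eulerPolygon B h u₀ s - eulerStep B h u₀ s‖
          ≤ M * (M * h) := by
        gcongr
        · exact hM _
        · exact norm_eulerPolygon_sub_eulerStep_le hM hh hs.1
      nlinarith)
  rw [h0] at this
  simpa using this

/-- Two Euler polygons with nodes in a set on which `B` is monotone are close to each other. -/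
theorem norm_eulerPolygon_sub_eulerPolygon_sq_le {h₁ h₂ T : ℝ} {S : Set V}
    (hM : ∀ v, ‖B v‖ ≤ M) (hh₁ : 0 < h₁) (hh₂ : 0 < h₂)
    (hS : ∀ v ∈ S, ∀ w ∈ S, 0 ≤ inner ℝ (B v - B w) (v - w))
    (h₁S : ∀ t, 0 ≤ t → t ≤ T → eulerStep B h₁ u₀ t ∈ S)
    (h₂S : ∀ t, 0 ≤ t → t ≤ T → eulerStep B h₂ u₀ t ∈ S) (hT : 0 ≤ T) :
    ‖eulerPolygon B h₁ u₀ T - eulerPolygon B h₂ u₀ T‖ ^ 2 ≤ 4 * M ^ 2 * (h₁ + h₂) * T := by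
  have hM0 : 0 ≤ M := (norm_nonneg _).trans (hM u₀)
  have := le_add_mul_of_hasDerivWithinAt_le
    (φ := fun t => ‖eulerPolygon B h₁ u₀ t - eulerPolygon B h₂ u₀ t‖ ^ 2)
    (φ' := fun t => 2 * inner ℝ (eulerPolygon B h₁ u₀ t - eulerPolygon B h₂ u₀ t)
      (-B (eulerStep B h₁ u₀ t) - -B (eulerStep B h₂ u₀ t)))
    (C := 4 * M ^ 2 * (h₁ + h₂)) hT
    (((continuous_eulerPolygon hM).sub (continuous_eulerPolygon hM)).norm.pow 2).continuousOn
    (fun s hs => ((hasDerivWithinAt_eulerPolygon hM hh₁ hs.1).sub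
      (hasDerivWithinAt_eulerPolygon hM hh₂ hs.1)).norm_sq)
    (fun s hs => by
      set a := eulerStep B h₁ u₀ s
      set b := eulerStep B h₂ u₀ s
      set x := eulerPolygon B h₁ u₀ s
      set y := eulerPolygon B h₂ u₀ s
      have e1 := hS a (h₁S s hs.1 hs.2.le) b (h₂S s hs.1 hs.2.le)
      -- Monotonicity controls the part coming from the nodes `a`, `b`; the deviations of the
      -- polygons from them contribute only order `h₁ + h₂`.
      have e2 : inner ℝ (x - y) (-B a - -B b)
          = -inner ℝ (B a - B b) (a - b) - inner ℝ (B a - B b) ((x - a) - (y - b)) := by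
        have : x - y = (a - b) + ((x - a) - (y - b)) := by abel
        rw [real_inner_comm, this, inner_add_right,
          show -B a - -B b = -(B a - B b) by abel, inner_neg_left, inner_neg_left]
        ring
      have e3 := (abs_le.1 (abs_real_inner_le_norm (B a - B b) ((x - a) - (y - b)))).1
      have e4 : ‖B a - B b‖ * ‖(x - a) - (y - b)‖ ≤ (M + M) * (M * h₁ + M * h₂) := by
        gcongr
        · exact (norm_sub_le _ _).trans (add_le_add (hM _) (hM _))
        · exact (norm_sub_le _ _).trans (add_le_add
            (norm_eulerPolygon_sub_eulerStep_le hM hh₁ hs.1)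
            (norm_eulerPolygon_sub_eulerStep_le hM hh₂ hs.1))
      nlinarith)
  simpa [eulerPolygon] using this

/-- For a small step the drift in `norm_eulerPolygon_sub_sq_le` is below `1`, and `r ^ 2 + 1 ≤ (r +
1) ^ 2`. The radius `‖u₀ - p‖ + 1` is the one at which the field gets truncated below, so the
truncation stays inactive at the nodes. -/
theorem eventually_forall_eulerPolygon_mem {p : V} (hM : ∀ v, ‖B v‖ ≤ M)
    (hp : ∀ v, 0 ≤ inner ℝ (B v) (v - p)) (T : ℝ) :
    ∀ᶠ h in 𝓝[>] (0 : ℝ), ∀ t, 0 ≤ t → t ≤ T → ‖eulerStep B h u₀ t - p‖ ≤ ‖u₀ - p‖ + 1 := by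
  have hM0 : 0 ≤ M := (norm_nonneg _).trans (hM u₀)
  have h1 : ∀ᶠ h in 𝓝[>] (0 : ℝ), 2 * M ^ 2 * h * T < 1 :=
    (((by fun_prop : Continuous fun h : ℝ => 2 * M ^ 2 * h * T).tendsto' 0 0 (by simp)).mono_left
      nhdsWithin_le_nhds).eventually (gt_mem_nhds one_pos)
  filter_upwards [h1, self_mem_nhdsWithin] with h h1 (hh : 0 < h) t ht htT
  rw [eulerStep, ← eulerPolygon_mul hM hh]
  have h2 := (le_div_iff₀ hh).1 (Nat.floor_le (div_nonneg ht hh.le))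
  have h3 := norm_eulerPolygon_sub_sq_le (u₀ := u₀) hM hh hp
    (t := ⌊t / h⌋₊ * h) (by positivity)
  have h4 : 2 * M ^ 2 * h * (⌊t / h⌋₊ * h) ≤ 2 * M ^ 2 * h * T := by
    gcongr; exact h2.trans htT
  have := norm_nonneg (u₀ - p)
  refine le_of_sq_le_sq ?_ (by positivity)
  nlinarith

/-- A continuous monotone field with a zero generates a global forward flow. -/
theorem exists_hasDerivWithinAt_of_monotone [FiniteDimensional ℝ V] {A : V → V}
    (hA : Continuous A) (hmono : ∀ v w, 0 ≤ inner ℝ (A v - A w) (v - w)) {p : V} (hp : A p = 0)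
    (u₀ : V) :
    ∃ u : ℝ → V, u 0 = u₀ ∧ ∀ t, 0 ≤ t → HasDerivWithinAt u (-A (u t)) (Ici 0) t := by
  have : ProperSpace V := FiniteDimensional.proper ℝ V
  set R := ‖u₀ - p‖ + 1 with hRdef
  have hR : 0 < R := by positivity
  -- Truncation makes the field bounded. Monotonicity survives only on the ball, but `B` still
  -- points away from `p` everywhere, because the retraction multiplies `v - p` by a positive
  -- factor.
  set B : V → V := fun v => A (ballRetraction p R v) with hB
  have hBc : Continuous B := hA.comp (continuous_ballRetraction hR)
  obtain ⟨M, hM⟩ : ∃ M, ∀ v, ‖B v‖ ≤ M := by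
    obtain ⟨M, hM⟩ := (isCompact_closedBall p R).exists_bound_of_continuousOn hA.continuousOn
    exact ⟨M, fun v => hM _ (mem_closedBall_iff_norm.2 (norm_ballRetraction_sub_le hR v))⟩
  have hM0 : 0 ≤ M := (norm_nonneg _).trans (hM u₀)
  have hBp : ∀ v, 0 ≤ inner ℝ (B v) (v - p) := by
    intro v
    have h1 := hmono (ballRetraction p R v) p
    have hm : 0 < max R ‖v - p‖ := lt_max_of_lt_left hR
    rw [hp, sub_zero, ballRetraction, add_sub_cancel_left, inner_smul_right] at h1
    exact nonneg_of_mul_nonneg_right h1 (by positivity)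
  have hBS : ∀ v ∈ Metric.closedBall p R, ∀ w ∈ Metric.closedBall p R,
      0 ≤ inner ℝ (B v - B w) (v - w) := by
    intro v hv w hw
    rw [mem_closedBall_iff_norm] at hv hw
    simp only [hB, ballRetraction_of_mem hR hv, ballRetraction_of_mem hR hw]
    exact hmono v w
  set h : ℕ → ℝ := fun n => 1 / ((n : ℝ) + 1) with hh
  have hpos : ∀ n, 0 < h n := fun n => by positivity
  have hlim : Tendsto h atTop (𝓝 0) := tendsto_one_div_add_atTop_nhds_zero_nat
  have hlim' : Tendsto h atTop (𝓝[>] 0) :=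
    tendsto_nhdsWithin_iff.2 ⟨hlim, Eventually.of_forall hpos⟩
  have hball : ∀ T, ∃ n₀, ∀ n ≥ n₀, ∀ t, 0 ≤ t → t ≤ T →
      eulerStep B (h n) u₀ t ∈ Metric.closedBall p R := fun T => by
    obtain ⟨n₀, hn⟩ := eventually_atTop.1
      (hlim'.eventually (eventually_forall_eulerPolygon_mem (u₀ := u₀) hM hBp T))
    exact ⟨n₀, fun n hnn t ht htT => mem_closedBall_iff_norm.2 (hn n hnn t ht htT)⟩
  have hcauchy : ∀ t, 0 ≤ t → ∃ v, Tendsto (fun n => eulerPolygon B (h n) u₀ t) atTop (𝓝 v) := by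
    intro t ht
    refine cauchySeq_tendsto_of_complete ?_
    obtain ⟨n₀, hn₀⟩ := hball t
    rw [Metric.cauchySeq_iff]
    intro η hη
    have hsmall : ∀ᶠ n in atTop, 4 * M ^ 2 * (h n + h n) * t < η ^ 2 :=
      (((by fun_prop : Continuous fun h : ℝ => 4 * M ^ 2 * (h + h) * t).tendsto' 0 0
        (by simp)).comp hlim).eventually (gt_mem_nhds (by positivity))
    obtain ⟨n₁, hn₁⟩ := eventually_atTop.1 hsmall
    refine ⟨max n₀ n₁, fun i hi j hj => ?_⟩
    have h1 := norm_eulerPolygon_sub_eulerPolygon_sq_le (u₀ := u₀) hM (hpos i) (hpos j) hBS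
      (hn₀ i ((le_max_left _ _).trans hi)) (hn₀ j ((le_max_left _ _).trans hj)) ht
    have h2 := hn₁ i ((le_max_right _ _).trans hi)
    have h3 := hn₁ j ((le_max_right _ _).trans hj)
    rw [dist_eq_norm]
    refine lt_of_pow_lt_pow_left₀ 2 hη.le ?_
    nlinarith
  choose! u hu using hcauchy
  have huLip : ∀ s t, 0 ≤ s → 0 ≤ t → ‖u t - u s‖ ≤ M * |t - s| := fun s t hs ht =>
    le_of_tendsto ((hu t ht).sub (hu s hs)).norm
      (Eventually.of_forall fun n => norm_eulerPolygon_sub_le hM s t)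
  -- Extending `u` by its initial value to negative times gives a continuous curve on the whole
  -- line, so that the fundamental theorem of calculus applies at `t = 0` as well.
  set w : ℝ → V := fun t => u (max t 0) with hw
  have hwc : Continuous w :=
    (LipschitzWith.of_dist_le_mul (K := ⟨M, hM0⟩) fun s t => by
      rw [dist_eq_norm, dist_eq_norm]
      refine (huLip _ _ (le_max_right _ _) (le_max_right _ _)).trans ?_
      show M * _ ≤ M * _
      gcongr
      exact abs_max_sub_max_le_abs s t 0).continuous
  have huR : ∀ t, 0 ≤ t → ‖u t - p‖ ≤ R := by
    intro t ht
    have h1 : Tendsto (fun n => ‖eulerPolygon B (h n) u₀ t - p‖) atTop (𝓝 ‖u t - p‖) :=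
      ((hu t ht).sub_const p).norm
    obtain ⟨n₀, hn₀⟩ := hball t
    have h3 : Tendsto (fun n => R + M * h n) atTop (𝓝 (R + M * 0)) :=
      (hlim.const_mul M).const_add R
    rw [mul_zero, add_zero] at h3
    refine le_of_tendsto_of_tendsto h1 h3 ?_
    filter_upwards [eventually_ge_atTop n₀] with n hn
    have h4 := mem_closedBall_iff_norm.1 (hn₀ n hn t ht le_rfl)
    have h5 := norm_eulerPolygon_sub_eulerStep_le (u₀ := u₀) hM (hpos n) ht
    calc _ = ‖(eulerStep B (h n) u₀ t - p)
          + (eulerPolygon B (h n) u₀ t - eulerStep B (h n) u₀ t)‖ := by congr 1; abel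
      _ ≤ _ := (norm_add_le _ _).trans (add_le_add h4 h5)
  have hstep : ∀ t, 0 ≤ t → Tendsto (fun n => eulerStep B (h n) u₀ t) atTop (𝓝 (u t)) := by
    intro t ht
    have h1 : Tendsto (fun n => eulerPolygon B (h n) u₀ t - eulerStep B (h n) u₀ t) atTop (𝓝 0) :=
      squeeze_zero_norm (fun n => norm_eulerPolygon_sub_eulerStep_le hM (hpos n) ht)
        (by simpa using hlim.const_mul M)
    simpa using (hu t ht).sub h1
  -- Dominated convergence takes the integral form of the Euler scheme to the limit;
  -- differentiability of `u` follows from this equation.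
  have hint : ∀ t, 0 ≤ t → u t = u₀ - ∫ s in (0 : ℝ)..t, B (w s) := by
    intro t ht
    refine tendsto_nhds_unique (hu t ht) (tendsto_const_nhds.sub ?_)
    refine intervalIntegral.tendsto_integral_filter_of_dominated_convergence (fun _ => M)
      (Eventually.of_forall fun n =>
        (stronglyMeasurable_comp_eulerStep B (h n) u₀).aestronglyMeasurable)
      (Eventually.of_forall fun n => Eventually.of_forall fun s _ => hM _)
      intervalIntegrable_const (Eventually.of_forall fun s hs => ?_)
    rw [uIoc_of_le ht] at hs
    have : w s = u s := by simp only [hw, max_eq_left hs.1.le]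
    rw [this]
    exact (hBc.tendsto _).comp (hstep s hs.1.le)
  refine ⟨u, by simpa using hint 0 le_rfl, fun t ht => ?_⟩
  have h1 := ((hBc.comp hwc).integral_hasStrictDerivAt 0 t).hasDerivAt.const_sub u₀
  have h2 : (B ∘ w) t = A (u t) := by
    simp only [hw, hB, Function.comp_apply, max_eq_left ht, ballRetraction_of_mem hR (huR t ht)]
  rw [h2] at h1
  exact h1.hasDerivWithinAt.congr (fun s hs => hint s hs) (hint t ht)

end Monotone

/-! ### Scalar linear differential equations with Hurwitz characteristic polynomial -/

section Cascade

open Polynomial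

/-- With `x k` in the role of the `k`-th derivative, this is the factorization of the operator `((X
- r) q)(d/dt)` as `d/dt - r` after `q(d/dt)`. -/
theorem sum_coeff_X_sub_C_mul {q : ℂ[X]} {n : ℕ} (hq : q.natDegree = n) (r : ℂ) (x : ℕ → ℂ) :
    ∑ k ∈ Finset.range (n + 2), ((X - C r) * q).coeff k * x k
      = ∑ k ∈ Finset.range (n + 1), q.coeff k * x (k + 1)
        - r * ∑ k ∈ Finset.range (n + 1), q.coeff k * x k := by
  simp only [sub_mul, coeff_sub, Finset.sum_sub_distrib, coeff_C_mul]
  congr 1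
  · rw [Finset.sum_range_succ']
    simp [coeff_X_mul]
  · rw [Finset.sum_range_succ, coeff_eq_zero_of_natDegree_lt (by omega : q.natDegree < n + 1),
      Finset.mul_sum]
    simp [mul_assoc]

theorem exists_eq_X_sub_C_mul {p : ℂ[X]} {n : ℕ} (hp : p.Monic) (hn : p.natDegree = n + 1) :
    ∃ (r : ℂ) (q : ℂ[X]), p = (X - C r) * q ∧ q.Monic ∧ q.natDegree = n := by
  obtain ⟨r, hr⟩ := Complex.exists_root (f := p) (natDegree_pos_iff_degree_pos.1 (by omega))
  obtain ⟨q, rfl⟩ := dvd_iff_isRoot.2 hr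
  have hq : q.Monic := (monic_X_sub_C r).of_mul_monic_left hp
  refine ⟨r, q, rfl, hq, ?_⟩
  rw [(monic_X_sub_C r).natDegree_mul hq, natDegree_X_sub_C] at hn
  omega

/-- Variation of constants. -/
theorem exists_first_order (r w₀ : ℂ) {g : ℝ → ℂ} (hg : Continuous g) :
    ∃ w : ℝ → ℂ, w 0 = w₀ ∧ ∀ t, HasDerivAt w (r * w t + g t) t := by
  have hE : ∀ (r : ℂ) (t : ℝ), HasDerivAt (fun t : ℝ => Complex.exp (r * t))
      (Complex.exp (r * t) * r) t := fun r t => by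
    simpa using ((Complex.ofRealCLM.hasDerivAt (x := t)).const_mul r).cexp
  have hc : Continuous fun s : ℝ => Complex.exp (-r * s) * g s := by fun_prop
  refine ⟨fun t => Complex.exp (r * t) * (w₀ + ∫ s in (0 : ℝ)..t, Complex.exp (-r * s) * g s),
    by simp, fun t => ?_⟩
  have := (hE r t).mul (((hc.integral_hasStrictDerivAt 0 t).hasDerivAt).const_add w₀)
  refine this.congr_deriv ?_
  have h1 : Complex.exp (r * t) * Complex.exp (-r * t) = 1 := by
    rw [← Complex.exp_add]; simp
  linear_combination g t * h1

/-- The initial value problem for `q(d/dt) x = g`, in terms of the derivatives `Y k` of `x`. -/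
theorem exists_cascade (n : ℕ) : ∀ (q : ℂ[X]), q.Monic → q.natDegree = n →
    ∀ (a : ℕ → ℂ) (g : ℝ → ℂ), Continuous g → ∃ Y : ℕ → ℝ → ℂ,
      (∀ k < n, ∀ t, HasDerivAt (Y k) (Y (k + 1) t) t) ∧
      (∀ t, ∑ k ∈ Finset.range (n + 1), q.coeff k * Y k t = g t) ∧ ∀ k < n, Y k 0 = a k := by
  induction n with
  | zero =>
    intro q hq hn a g _
    refine ⟨fun _ => g, by simp, fun t => ?_, by simp⟩
    have : q.coeff 0 = 1 := by rw [← hn]; exact hq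
    simp [this]
  | succ n ih =>
    intro p hp hn a g hg
    obtain ⟨r, q, rfl, hq, hqn⟩ := exists_eq_X_sub_C_mul hp hn
    -- `w` plays the role of `q(d/dt) x`; its initial value is dictated by the prescribed
    -- derivatives of `x`.
    obtain ⟨w, hw0, hw⟩ := exists_first_order r
      (∑ k ∈ Finset.range (n + 1), q.coeff k * a k) hg
    have hwc : Continuous w := continuous_iff_continuousAt.2 fun t => (hw t).continuousAt
    obtain ⟨Y, hY, hYw, hY0⟩ := ih q hq hqn a w hwc
    have hlead : q.coeff n = 1 := by rw [← hqn]; exact hq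
    -- The induction hypothesis says nothing about `Y (n + 1)`. As `q` is monic, `Y n` equals `w`
    -- minus lower derivatives, and differentiating this relation yields the new top derivative.
    set top : ℝ → ℂ := fun t =>
      (r * w t + g t) - ∑ k ∈ Finset.range n, q.coeff k * Y (k + 1) t with htop
    set Z : ℕ → ℝ → ℂ := fun k => if k = n + 1 then top else Y k with hZ
    have hZle : ∀ k, k ≤ n → Z k = Y k := fun k hk => by
      simp only [hZ]; rw [if_neg (by omega)]
    have hZtop : Z (n + 1) = top := by simp [hZ]
    have hYn : Y n = fun t => w t - ∑ k ∈ Finset.range n, q.coeff k * Y k t := by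
      funext t
      have := hYw t
      rw [Finset.sum_range_succ, hlead, one_mul] at this
      rw [← this]; ring
    refine ⟨Z, fun k hk t => ?_, fun t => ?_, fun k hk => ?_⟩
    · rcases Nat.lt_succ_iff_lt_or_eq.1 hk with hk | rfl
      · rw [hZle k hk.le, hZle (k + 1) hk]; exact hY k hk t
      · rw [hZle k le_rfl, hZtop, hYn]
        exact (hw t).sub (HasDerivAt.fun_sum fun j hj =>
          (hY j (Finset.mem_range.1 hj) t).const_mul _)
    · rw [sum_coeff_X_sub_C_mul hqn r (fun k => Z k t), Finset.sum_range_succ, hZtop, hlead]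
      have h1 : ∑ k ∈ Finset.range (n + 1), q.coeff k * Z k t = w t := by
        rw [← hYw t]
        exact Finset.sum_congr rfl fun k hk => by rw [hZle k (by simp at hk; omega)]
      have h2 : ∑ k ∈ Finset.range n, q.coeff k * Z (k + 1) t
          = ∑ k ∈ Finset.range n, q.coeff k * Y (k + 1) t :=
        Finset.sum_congr rfl fun k hk => by rw [hZle (k + 1) (by simp at hk; omega)]
      rw [h1, h2, htop]; ring
    · rw [hZle k (by omega)]
      rcases Nat.lt_succ_iff_lt_or_eq.1 hk with hk | rfl
      · exact hY0 k hk
      · refine (congrFun hYn 0).trans ?_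
        have h3 : ∑ j ∈ Finset.range k, q.coeff j * Y j 0 = ∑ j ∈ Finset.range k, q.coeff j * a j :=
          Finset.sum_congr rfl fun j hj => by rw [hY0 j (Finset.mem_range.1 hj)]
        change w 0 - ∑ j ∈ Finset.range k, q.coeff j * Y j 0 = a k
        rw [hw0, Finset.sum_range_succ, hlead, h3]
        ring

/-- Decay estimate for a stable first-order linear equation. -/
theorem norm_le_of_first_order {w g : ℝ → ℂ} {r : ℂ} {T γ K : ℝ} (hγ : γ < -r.re)
    (hw : ∀ t, T ≤ t → HasDerivWithinAt w (r * w t + g t) (Ici T) t)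
    (hg : ∀ t, T ≤ t → ‖g t‖ ≤ K * Real.exp (-γ * (t - T))) {t : ℝ} (ht : T ≤ t) :
    ‖w t‖ ≤ ‖w T‖ * Real.exp (r.re * (t - T)) + K / (-r.re - γ) * Real.exp (-γ * (t - T)) := by
  have hK : 0 ≤ K := by simpa using (norm_nonneg _).trans (hg T le_rfl)
  have hpos : 0 < -r.re - γ := by linarith
  have hE : ∀ t : ℝ, HasDerivAt (fun t : ℝ => Complex.exp (-r * (t - T)))
      (Complex.exp (-r * (t - T)) * -r) t := fun t => by
    simpa using (((Complex.ofRealCLM.hasDerivAt (x := t)).sub_const (T : ℂ)).const_mul (-r)).cexp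
  have hEn : ∀ t : ℝ, ‖Complex.exp (-r * (t - T))‖ = Real.exp (-r.re * (t - T)) := fun t => by
    rw [Complex.norm_exp, ← Complex.ofReal_sub]; simp
  -- The integrating factor removes `r * w`, leaving a derivative of norm at most `K * exp ((-r.re -
  -- γ) * (t - T))`.
  have hv : ∀ t, T ≤ t → HasDerivWithinAt (fun t : ℝ => Complex.exp (-r * (t - T)) * w t)
      (Complex.exp (-r * (t - T)) * g t) (Ici T) t := fun t ht => by
    refine ((hE t).hasDerivWithinAt.mul (hw t ht)).congr_deriv ?_
    ring
  have hB : ∀ t, HasDerivAt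
      (fun t => ‖w T‖ + K / (-r.re - γ) * Real.exp ((-r.re - γ) * (t - T)))
      (K * Real.exp ((-r.re - γ) * (t - T))) t := fun t => by
    refine ((((((hasDerivAt_id t).sub_const T).const_mul (-r.re - γ)).exp).const_mul
      (K / (-r.re - γ))).const_add ‖w T‖).congr_deriv ?_
    simp only [id]
    field_simp
  have := image_norm_le_of_norm_deriv_right_le_deriv_boundary (a := T) (b := t)
    (f := fun t : ℝ => Complex.exp (-r * (t - T)) * w t)
    (f' := fun t : ℝ => Complex.exp (-r * (t - T)) * g t)
    (fun s hs => ((hv s hs.1).mono (fun q hq => hq.1)).continuousWithinAt)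
    (fun s hs => (hv s hs.1).Ici_of_Ici hs.1)
    (by simp; positivity) hB
    (fun s hs => by
      rw [norm_mul, hEn]
      calc _ ≤ Real.exp (-r.re * (s - T)) * (K * Real.exp (-γ * (s - T))) := by
            gcongr; exact hg s hs.1
        _ = _ := by rw [mul_left_comm, ← Real.exp_add]; ring_nf) (right_mem_Icc.2 ht)
  simp only [norm_mul, hEn] at this
  have h1 : Real.exp (r.re * (t - T)) * Real.exp (-r.re * (t - T)) = 1 := by
    rw [← Real.exp_add]; simp
  have h2 : Real.exp (r.re * (t - T)) * Real.exp ((-r.re - γ) * (t - T))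
      = Real.exp (-γ * (t - T)) := by
    rw [← Real.exp_add]; ring_nf
  calc ‖w t‖ = Real.exp (r.re * (t - T)) * (Real.exp (-r.re * (t - T)) * ‖w t‖) := by
        rw [← mul_assoc, h1, one_mul]
    _ ≤ Real.exp (r.re * (t - T)) *
        (‖w T‖ + K / (-r.re - γ) * Real.exp ((-r.re - γ) * (t - T))) := by gcongr
    _ = _ := by rw [← h2]; ring

/-- The curves that vanish at infinity. -/
def vanishing : Submodule ℂ (ℝ → ℂ) where
  carrier := {g | Tendsto g atTop (𝓝 0)}
  add_mem' ha hb := by rw [← add_zero (0 : ℂ)]; exact Tendsto.add ha hb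
  zero_mem' := tendsto_const_nhds
  smul_mem' c g hg := by rw [← smul_zero c]; exact Tendsto.const_smul hg c

/-- The curves that decay at the exponential rate `γ` on `[0, ∞)`. -/
def expDecaying (γ : ℝ) : Submodule ℂ (ℝ → ℂ) where
  carrier := {g | ∃ K, ∀ t, 0 ≤ t → ‖g t‖ ≤ K * Real.exp (-γ * t)}
  add_mem' := by
    rintro a b ⟨K, hK⟩ ⟨L, hL⟩
    refine ⟨K + L, fun t ht => (norm_add_le _ _).trans ?_⟩
    rw [add_mul]
    exact add_le_add (hK t ht) (hL t ht)
  zero_mem' := ⟨0, by simp⟩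
  smul_mem' := by
    rintro c g ⟨K, hK⟩
    refine ⟨‖c‖ * K, fun t ht => ?_⟩
    rw [Pi.smul_apply, norm_smul, mul_assoc]
    gcongr
    exact hK t ht

theorem first_order_mem_expDecaying {w g : ℝ → ℂ} {r : ℂ} {γ : ℝ} (hγ : γ < -r.re)
    (hw : ∀ t, 0 ≤ t → HasDerivWithinAt w (r * w t + g t) (Ici 0) t)
    (hg : g ∈ expDecaying γ) : w ∈ expDecaying γ := by
  obtain ⟨K, hK⟩ := hg
  refine ⟨‖w 0‖ + K / (-r.re - γ), fun t ht => ?_⟩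
  have h1 := norm_le_of_first_order (K := K) hγ hw (by simpa using hK) ht
  rw [sub_zero] at h1
  refine h1.trans ?_
  rw [add_mul]
  gcongr
  linarith

/-- Restarting at a late time `T`, when `‖g‖` is below `η / 2 * -r.re`, the estimate with `γ = 0`
bounds `‖w‖` by a decaying term plus `η / 2`. -/
theorem first_order_mem_vanishing {w g : ℝ → ℂ} {r : ℂ} (hr : r.re < 0)
    (hw : ∀ t, 0 ≤ t → HasDerivWithinAt w (r * w t + g t) (Ici 0) t)
    (hg : g ∈ vanishing) : w ∈ vanishing := by
  change Tendsto w atTop (𝓝 0)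
  change Tendsto g atTop (𝓝 0) at hg
  rw [Metric.tendsto_atTop] at hg ⊢
  intro η hη
  have hr' : 0 < -r.re := by linarith
  obtain ⟨T₀, hT₀⟩ := hg (η / 2 * -r.re) (by positivity)
  set T := max T₀ 0
  have hb : ∀ t, T ≤ t → ‖w t‖ ≤ ‖w T‖ * Real.exp (r.re * (t - T)) + η / 2 := fun t ht => by
    have := norm_le_of_first_order (γ := 0) (K := η / 2 * -r.re) hr'
      (fun s hs => (hw s ((le_max_right _ _).trans hs)).mono
        (Ici_subset_Ici.2 (le_max_right T₀ 0)))
      (fun s hs => by simpa using (hT₀ s ((le_max_left _ _).trans hs)).le) ht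
    simp only [sub_zero, neg_zero, zero_mul, Real.exp_zero, mul_one] at this
    rwa [mul_div_assoc, div_self hr'.ne', mul_one] at this
  have hlim : Tendsto (fun t => ‖w T‖ * Real.exp (r.re * (t - T))) atTop (𝓝 0) := by
    have h1 : Tendsto (fun t => r.re * (t - T)) atTop atBot :=
      (tendsto_atTop_add_const_right _ (-T) tendsto_id).const_mul_atTop_of_neg hr
    simpa using (Real.tendsto_exp_atBot.comp h1).const_mul ‖w T‖
  obtain ⟨T₁, hT₁⟩ := eventually_atTop.1 (hlim.eventually (gt_mem_nhds (half_pos hη)))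
  refine ⟨max T T₁, fun t ht => ?_⟩
  rw [dist_zero_right]
  have := hb t ((le_max_left _ _).trans ht)
  have := hT₁ t ((le_max_right _ _).trans ht)
  linarith

/-- Stability properties pass from the input of `q(d/dt) x = g` to the derivatives of `x`
as soon as they do so for the first-order factors of `q`. -/
theorem cascade_mem (S : Submodule ℂ (ℝ → ℂ)) (n : ℕ) : ∀ (q : ℂ[X]), q.Monic →
    q.natDegree = n →
    (∀ r, q.IsRoot r → ∀ w g : ℝ → ℂ,
      (∀ t, 0 ≤ t → HasDerivWithinAt w (r * w t + g t) (Ici 0) t) → g ∈ S → w ∈ S) →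
    ∀ (Y : ℕ → ℝ → ℂ) (g : ℝ → ℂ),
      (∀ k < n, ∀ t, 0 ≤ t → HasDerivWithinAt (Y k) (Y (k + 1) t) (Ici 0) t) →
      (∀ t, 0 ≤ t → ∑ k ∈ Finset.range (n + 1), q.coeff k * Y k t = g t) → g ∈ S →
      ∀ k < n, Y k ∈ S := by
  induction n with
  | zero => intros; omega
  | succ n ih =>
    intro p hp hn hS Y g hY hYg hg
    obtain ⟨r, q, rfl, hq, hqn⟩ := exists_eq_X_sub_C_mul hp hn
    set w : ℝ → ℂ := fun t => ∑ k ∈ Finset.range (n + 1), q.coeff k * Y k t with hw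
    have hlead : q.coeff n = 1 := by rw [← hqn]; exact hq
    have hwS : w ∈ S := by
      refine hS r (by simp [IsRoot]) w g (fun t ht => ?_) hg
      have h1 : HasDerivWithinAt w (∑ k ∈ Finset.range (n + 1), q.coeff k * Y (k + 1) t)
          (Ici 0) t := HasDerivWithinAt.fun_sum fun j hj =>
        (hY j (Finset.mem_range.1 hj) t ht).const_mul _
      refine h1.congr_deriv ?_
      rw [← hYg t ht, sum_coeff_X_sub_C_mul hqn r (fun k => Y k t)]
      ring
    have hlow := ih q hq hqn (fun s hs => hS s (by
      simp only [IsRoot, eval_mul, mul_eq_zero]; exact Or.inr hs)) Y w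
      (fun k hk => hY k (by omega)) (fun t _ => rfl) hwS
    intro k hk
    rcases Nat.lt_succ_iff_lt_or_eq.1 hk with hk | rfl
    · exact hlow k hk
    · have : Y k = w - ∑ j ∈ Finset.range k, q.coeff j • Y j := by
        funext t
        simp only [hw, Pi.sub_apply, Finset.sum_apply, Pi.smul_apply, smul_eq_mul]
        rw [Finset.sum_range_succ, hlead]; ring
      rw [this]
      exact S.sub_mem hwS (S.sum_mem fun j hj => S.smul_mem _ (hlow j (Finset.mem_range.1 hj)))

end Cascade

/-! ### Primal-dual gradient flows -/

section PrimalDual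

variable {H : Type*} [NormedAddCommGroup H] [InnerProductSpace ℝ H]

/-- `(z, l)` is a forward trajectory of the primal-dual flow of the field `F` under the linear
constraint `L z = 0`. -/
structure IsPrimalDualTrajectory (F : H → H) (L : H →L[ℝ] H) (z l : ℝ → H) : Prop where
  primal : ∀ t, 0 ≤ t → HasDerivWithinAt z (-F (z t) - L (l t)) (Ici 0) t
  dual : ∀ t, 0 ≤ t → HasDerivWithinAt l (L (z t)) (Ici 0) t

variable {F : H → H} {L : H →L[ℝ] H} {p q : H}

/-- The field `(z, l) ↦ (F z + L l, -L z)` is monotone, because symmetry of `L` makes the coupling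
terms cancel, and it vanishes at `(p, q)`. The `WithLp 2` product supplies the inner product. -/
theorem exists_primalDual [FiniteDimensional ℝ H] (hL : (L : H →ₗ[ℝ] H).IsSymmetric)
    (hF : Continuous F) (hmono : ∀ v w, 0 ≤ inner ℝ (F v - F w) (v - w))
    (hp : L p = 0) (hq : F p + L q = 0) (z₀ l₀ : H) :
    ∃ z l : ℝ → H, IsPrimalDualTrajectory F L z l ∧ z 0 = z₀ ∧ l 0 = l₀ := by
  set A : WithLp 2 (H × H) → WithLp 2 (H × H) := fun v =>
    WithLp.toLp 2 (F v.fst + L v.snd, -L v.fst) with hA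
  have hAc : Continuous A := by
    refine (WithLp.prod_continuous_toLp 2 H H).comp (Continuous.prodMk ?_ ?_)
    · exact (hF.comp (WithLp.fstL 2 ℝ H H).continuous).add
        (L.continuous.comp (WithLp.sndL 2 ℝ H H).continuous)
    · exact (L.continuous.comp (WithLp.fstL 2 ℝ H H).continuous).neg
  have hAm : ∀ v w, 0 ≤ inner ℝ (A v - A w) (v - w) := by
    intro v w
    have h1 := hmono v.fst w.fst
    have h2 : inner ℝ (L (v.snd - w.snd)) (v.fst - w.fst)
        = inner ℝ (v.snd - w.snd) (L (v.fst - w.fst)) := hL _ _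
    have h3 : inner ℝ (A v - A w) (v - w) = inner ℝ (F v.fst - F w.fst) (v.fst - w.fst)
        + inner ℝ (L (v.snd - w.snd)) (v.fst - w.fst)
        - inner ℝ (L (v.fst - w.fst)) (v.snd - w.snd) := by
      have e1 : (A v - A w).fst = (F v.fst - F w.fst) + L (v.snd - w.snd) := by
        change F v.fst + L v.snd - (F w.fst + L w.snd) = _
        rw [map_sub]; abel
      have e2 : (A v - A w).snd = -L (v.fst - w.fst) := by
        change -L v.fst - -L w.fst = _
        rw [map_sub]; abel
      rw [WithLp.prod_inner_apply]
      change inner ℝ (A v - A w).fst (v - w).fst + inner ℝ (A v - A w).snd (v - w).snd = _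
      rw [e1, e2, inner_add_left, inner_neg_left, WithLp.sub_fst, WithLp.sub_snd]
      ring
    rw [h3, h2, real_inner_comm (L (v.fst - w.fst))]
    linarith
  have hA0 : A (WithLp.toLp 2 (p, q)) = 0 := by
    change WithLp.toLp 2 (F p + L q, -L p) = 0
    rw [hq, hp, neg_zero]; rfl
  obtain ⟨u, hu0, hu⟩ := exists_hasDerivWithinAt_of_monotone hAc hAm hA0 (WithLp.toLp 2 (z₀, l₀))
  refine ⟨fun t => (u t).fst, fun t => (u t).snd, ⟨fun t ht => ?_, fun t ht => ?_⟩, ?_, ?_⟩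
  · have := (WithLp.fstL 2 ℝ H H).hasFDerivAt.comp_hasDerivWithinAt t (hu t ht)
    refine this.congr_deriv ?_
    change -(F (u t).fst + L (u t).snd) = _
    abel
  · have := (WithLp.sndL 2 ℝ H H).hasFDerivAt.comp_hasDerivWithinAt t (hu t ht)
    refine this.congr_deriv ?_
    change - -L (u t).fst = _
    abel
  · simp [hu0]
  · simp [hu0]

/-- The derivative of the distance to an equilibrium along the primal-dual flow. -/
theorem IsPrimalDualTrajectory.hasDerivWithinAt_norm_sq {z l : ℝ → H}
    (hL : (L : H →ₗ[ℝ] H).IsSymmetric) (hp : L p = 0) (hq : F p + L q = 0)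
    (h : IsPrimalDualTrajectory F L z l) (t : ℝ) (ht : 0 ≤ t) :
    HasDerivWithinAt (fun t => ‖z t - p‖ ^ 2 + ‖l t - q‖ ^ 2)
      (-(2 * inner ℝ (F (z t) - F p) (z t - p))) (Ici 0) t := by
  refine (((h.primal t ht).sub_const p).norm_sq.add
    ((h.dual t ht).sub_const q).norm_sq).congr_deriv ?_
  have h1 : inner ℝ (L (l t - q)) (z t - p) = inner ℝ (l t - q) (L (z t - p)) := hL _ _
  have h2 : -F (z t) - L (l t) = -(F (z t) - F p) - L (l t - q) := by
    rw [map_sub, eq_neg_of_add_eq_zero_left hq]; abel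
  rw [map_sub L (z t), hp, sub_zero] at h1
  rw [h2, ← h1, real_inner_comm, inner_sub_left, inner_neg_left]
  ring

theorem IsPrimalDualTrajectory.norm_sq_le {z l : ℝ → H}
    (hL : (L : H →ₗ[ℝ] H).IsSymmetric) (hmono : ∀ v w, 0 ≤ inner ℝ (F v - F w) (v - w))
    (hp : L p = 0) (hq : F p + L q = 0)
    (h : IsPrimalDualTrajectory F L z l) {t : ℝ} (ht : 0 ≤ t) :
    ‖z t - p‖ ^ 2 + ‖l t - q‖ ^ 2 ≤ ‖z 0 - p‖ ^ 2 + ‖l 0 - q‖ ^ 2 :=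
  antitoneOn_Ici_of_hasDerivWithinAt_nonpos (h.hasDerivWithinAt_norm_sq hL hp hq)
    (fun t _ => by linarith [hmono (z t) p]) self_mem_Ici ht ht

theorem IsPrimalDualTrajectory.exists_norm_le {z l : ℝ → H}
    (hL : (L : H →ₗ[ℝ] H).IsSymmetric) (hmono : ∀ v w, 0 ≤ inner ℝ (F v - F w) (v - w))
    (hp : L p = 0) (hq : F p + L q = 0) (h : IsPrimalDualTrajectory F L z l) :
    ∃ R, ∀ t, 0 ≤ t → ‖z t - p‖ ≤ R ∧ ‖l t - q‖ ≤ R := by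
  refine ⟨√(‖z 0 - p‖ ^ 2 + ‖l 0 - q‖ ^ 2), fun t ht => ?_⟩
  have := h.norm_sq_le hL hmono hp hq ht
  constructor <;> apply Real.le_sqrt_of_sq_le <;> nlinarith [sq_nonneg ‖z t - p‖, sq_nonneg ‖l t - q‖]

/-- Boundedness of `z` and `l` bounds the speed of `z`, and strict monotonicity makes the
dissipation positive away from `p`; `tendsto_of_lyapunov` then applies. -/
theorem IsPrimalDualTrajectory.tendsto [FiniteDimensional ℝ H] {z l : ℝ → H}
    (hL : (L : H →ₗ[ℝ] H).IsSymmetric) (hF : Continuous F)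
    (hmono : ∀ v w, v ≠ w → 0 < inner ℝ (F v - F w) (v - w))
    (hp : L p = 0) (hq : F p + L q = 0) (h : IsPrimalDualTrajectory F L z l) :
    Tendsto z atTop (𝓝 p) := by
  have : ProperSpace H := FiniteDimensional.proper ℝ H
  have hmono' : ∀ v w, 0 ≤ inner ℝ (F v - F w) (v - w) := fun v w => by
    rcases eq_or_ne v w with rfl | hvw
    · simp
    · exact (hmono v w hvw).le
  obtain ⟨R, hR⟩ := h.exists_norm_le hL hmono' hp hq
  obtain ⟨M, hM⟩ := (isCompact_closedBall p R).exists_bound_of_continuousOn hF.continuousOn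
  have hMz : ∀ t, 0 ≤ t → ‖-F (z t) - L (l t)‖ ≤ M + ‖L‖ * (R + ‖q‖) := by
    intro t ht
    rw [← neg_add', norm_neg]
    refine (norm_add_le _ _).trans (add_le_add
      (hM _ (mem_closedBall_iff_norm.2 (hR t ht).1)) ((L.le_opNorm _).trans ?_))
    gcongr
    have := norm_add_le (l t - q) q
    rw [sub_add_cancel] at this
    linarith [(hR t ht).2]
  refine tendsto_of_lyapunov (W := fun v => 2 * inner ℝ (F v - F p) (v - p))
    (fun t _ => by positivity) (h.hasDerivWithinAt_norm_sq hL hp hq) (by fun_prop)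
    (fun v => by linarith [hmono' v p]) (fun v hv => by linarith [hmono v p hv])
    (fun t ht => (hR t ht).1) (M := M + ‖L‖ * (R + ‖q‖)) fun s t hs hst => ?_
  exact norm_image_sub_le_of_norm_deriv_right_le_segment (a := s) (b := t)
    (f' := fun r => -F (z r) - L (l r))
    (fun r hr => ((h.primal r (hs.trans hr.1)).mono (fun x hx => hs.trans hx.1)).continuousWithinAt)
    (fun r hr => (h.primal r (hs.trans hr.1)).Ici_of_Ici (hs.trans hr.1))
    (fun r hr => hMz r (hs.trans hr.1)) t (right_mem_Icc.2 hst)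

/-- The kernel of a symmetric operator is orthogonal to its range, so `L` is injective on its range,
and in finite dimension it is bounded below there. -/
theorem exists_pos_mul_norm_le_of_isSymmetric [FiniteDimensional ℝ H]
    (hL : (L : H →ₗ[ℝ] H).IsSymmetric) :
    ∃ σ > 0, ∀ w ∈ LinearMap.range (L : H →ₗ[ℝ] H), σ * ‖w‖ ≤ ‖L w‖ := by
  set U := LinearMap.range (L : H →ₗ[ℝ] H) with hU
  have hker : LinearMap.ker ((L : H →ₗ[ℝ] H) ∘ₗ U.subtype) = ⊥ := by
    rw [LinearMap.ker_eq_bot']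
    intro w hw
    have h1 : (w : H) ∈ Uᗮ := by
      rw [show Uᗮ = _ from hL.orthogonal_range]; exact hw
    have h2 := (Submodule.mem_orthogonal U (w : H)).1 h1 w w.2
    exact Subtype.ext (inner_self_eq_zero.1 h2)
  obtain ⟨K, hK, hanti⟩ := LinearMap.exists_antilipschitzWith _ hker
  refine ⟨(K : ℝ)⁻¹, by positivity, fun w hw => ?_⟩
  have h1 := hanti.le_mul_dist ⟨w, hw⟩ 0
  have hK' : (0 : ℝ) < K := hK
  rw [inv_mul_le_iff₀ hK']
  simpa [dist_zero_right] using h1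

/-- Exponential convergence of the primal variable, at a rate that does not depend on the
trajectory. -/
theorem exists_rate_primalDual [FiniteDimensional ℝ H] {ω ϑ : ℝ} (hω : 0 < ω)
    (hL : (L : H →ₗ[ℝ] H).IsSymmetric)
    (hmono : ∀ v w, ω * ‖v - w‖ ^ 2 ≤ inner ℝ (F v - F w) (v - w))
    (hlip : ∀ v w, ‖F v - F w‖ ≤ ϑ * ‖v - w‖) (hp : L p = 0) (hq : F p + L q = 0) :
    ∃ γ > 0, ∀ z l : ℝ → H, IsPrimalDualTrajectory F L z l →
      ∃ K, ∀ t, 0 ≤ t → ‖z t - p‖ ≤ K * Real.exp (-γ * t) := by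
  obtain ⟨σ, hσ, hσL⟩ := exists_pos_mul_norm_le_of_isSymmetric hL
  set U := LinearMap.range (L : H →ₗ[ℝ] H) with hU
  -- The first bound lets half of the strong monotonicity absorb the errors caused by the cross term
  -- in `Φ`; the second keeps `Φ` comparable to `‖e‖ ^ 2 + ‖w‖ ^ 2`.
  set δ := min (ω / (ϑ ^ 2 + 2 * ‖L‖ ^ 2 + 1)) (1 / (2 * (‖L‖ + 1))) with hδ
  have hδp : 0 < δ := by positivity
  have hδ1 : δ * (ϑ ^ 2 / 2 + ‖L‖ ^ 2) ≤ ω / 2 := by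
    have : δ * (ϑ ^ 2 + 2 * ‖L‖ ^ 2 + 1) ≤ ω := by
      rw [← le_div_iff₀ (by positivity)]; exact min_le_left _ _
    linarith
  have hδ2 : δ * ‖L‖ ≤ 1 / 2 := by
    have : δ * (2 * (‖L‖ + 1)) ≤ 1 := by
      rw [← le_div_iff₀ (by positivity)]; exact min_le_right _ _
    linarith
  set κ := min (ω / 2) (δ * σ ^ 2 / 2) with hκ
  have hκp : 0 < κ := by positivity
  refine ⟨κ / 2, by positivity, fun z l h => ?_⟩
  set e : ℝ → H := fun t => z t - p with he
  -- The component of `l - q` in `ker L` is constant in time and does not decay, so only the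
  -- component in the range enters `Φ`.
  set w : ℝ → H := fun t => U.starProjection (l t - q) with hw
  have hLw : ∀ t, L (w t) = L (l t - q) := by
    intro t
    have h1 : l t - q - w t ∈ Uᗮ := Submodule.sub_starProjection_mem_orthogonal _
    rw [hU, hL.orthogonal_range] at h1
    have h2 : L (l t - q - w t) = 0 := h1
    rw [map_sub, sub_eq_zero] at h2
    exact h2.symm
  have hLe : ∀ t, L (e t) = L (z t) := fun t => by simp only [he, map_sub, hp, sub_zero]
  have hσw : ∀ t, σ * ‖w t‖ ≤ ‖L (w t)‖ := fun t =>
    hσL _ (Submodule.starProjection_apply_mem _ _)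
  have he' : ∀ t, 0 ≤ t → HasDerivWithinAt e (-(F (z t) - F p) - L (w t)) (Ici 0) t := by
    intro t ht
    refine ((h.primal t ht).sub_const p).congr_deriv ?_
    rw [hLw, map_sub, eq_neg_of_add_eq_zero_left hq]; abel
  have hw' : ∀ t, 0 ≤ t → HasDerivWithinAt w (L (e t)) (Ici 0) t := by
    intro t ht
    refine (U.starProjection.hasFDerivAt.comp_hasDerivWithinAt t
      ((h.dual t ht).sub_const q)).congr_deriv ?_
    rw [hLe]
    exact Submodule.starProjection_eq_self_iff.2 ⟨z t, rfl⟩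
  -- The plain energy dissipates only in `e`. Differentiating the cross term produces `-δ * ‖L (w
  -- t)‖ ^ 2`, which controls `w` through `σ`.
  set Φ : ℝ → ℝ := fun t =>
    (1 / 2) * (‖e t‖ ^ 2 + ‖w t‖ ^ 2) + δ * inner ℝ (e t) (L (w t)) with hΦ
  have hcross : ∀ t, |δ * inner ℝ (e t) (L (w t))| ≤ 1 / 4 * (‖e t‖ ^ 2 + ‖w t‖ ^ 2) := by
    intro t
    rw [abs_mul, abs_of_pos hδp]
    calc δ * |inner ℝ (e t) (L (w t))| ≤ δ * (‖e t‖ * (‖L‖ * ‖w t‖)) := by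
          gcongr
          exact (abs_real_inner_le_norm _ _).trans (by gcongr; exact L.le_opNorm _)
      _ = δ * ‖L‖ * (‖e t‖ * ‖w t‖) := by ring
      _ ≤ 1 / 2 * (‖e t‖ * ‖w t‖) := by gcongr
      _ ≤ _ := by nlinarith [sq_nonneg (‖e t‖ - ‖w t‖)]
  have hΦ' : ∀ t, 0 ≤ t → HasDerivWithinAt Φ
      (-inner ℝ (F (z t) - F p) (e t) - δ * inner ℝ (F (z t) - F p) (L (w t))
        - δ * ‖L (w t)‖ ^ 2 + δ * ‖L (e t)‖ ^ 2) (Ici 0) t := by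
    intro t ht
    refine ((((he' t ht).norm_sq.add (hw' t ht).norm_sq).const_mul (1 / 2)).add
      (((he' t ht).inner ℝ (L.hasFDerivAt.comp_hasDerivWithinAt t (hw' t ht))).const_mul
        δ)).congr_deriv ?_
    have h1 : inner ℝ (L (e t)) (L (e t)) = inner ℝ (e t) (L (L (e t))) := hL _ _
    have h2 : inner ℝ (L (w t)) (e t) = inner ℝ (w t) (L (e t)) := hL _ _
    simp only [Function.comp_apply]
    rw [← h1, ← h2, real_inner_comm (-(F (z t) - F p) - L (w t)) (e t), inner_sub_left,
      inner_sub_left, inner_neg_left, inner_neg_left, real_inner_self_eq_norm_sq,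
      real_inner_self_eq_norm_sq]
    ring
  have hdecay : ∀ t, 0 ≤ t → -inner ℝ (F (z t) - F p) (e t)
      - δ * inner ℝ (F (z t) - F p) (L (w t))
        - δ * ‖L (w t)‖ ^ 2 + δ * ‖L (e t)‖ ^ 2 ≤ -κ * Φ t := by
    intro t ht
    have h1 : ω * ‖e t‖ ^ 2 ≤ inner ℝ (F (z t) - F p) (e t) := hmono (z t) p
    have h2 : ‖F (z t) - F p‖ ^ 2 ≤ ϑ ^ 2 * ‖e t‖ ^ 2 := by
      rw [← mul_pow]; gcongr; exact hlip (z t) p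
    have h3 := (abs_le.1 (abs_real_inner_le_norm (F (z t) - F p) (L (w t)))).1
    have h4 : ‖L (e t)‖ ^ 2 ≤ ‖L‖ ^ 2 * ‖e t‖ ^ 2 := by
      rw [← mul_pow]; gcongr; exact L.le_opNorm _
    have h5 : σ ^ 2 * ‖w t‖ ^ 2 ≤ ‖L (w t)‖ ^ 2 := by
      rw [← mul_pow]; gcongr; exact hσw t
    have h6 : -inner ℝ (F (z t) - F p) (L (w t)) ≤ ϑ ^ 2 / 2 * ‖e t‖ ^ 2 + ‖L (w t)‖ ^ 2 / 2 := by
      nlinarith [sq_nonneg (‖F (z t) - F p‖ - ‖L (w t)‖)]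
    have h7 := mul_le_mul_of_nonneg_left h6 hδp.le
    have h8 := mul_le_mul_of_nonneg_left h4 hδp.le
    have h9 := mul_le_mul_of_nonneg_left h5 hδp.le
    have h10 := mul_le_mul_of_nonneg_right hδ1 (sq_nonneg ‖e t‖)
    have h11 := mul_le_mul_of_nonneg_right (min_le_left (ω / 2) (δ * σ ^ 2 / 2)) (sq_nonneg ‖e t‖)
    have h12 := mul_le_mul_of_nonneg_right (min_le_right (ω / 2) (δ * σ ^ 2 / 2)) (sq_nonneg ‖w t‖)
    rw [← hκ] at h11 h12
    have h13 : Φ t ≤ ‖e t‖ ^ 2 + ‖w t‖ ^ 2 := by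
      have := (abs_le.1 (hcross t)).2
      have := sq_nonneg ‖e t‖
      have := sq_nonneg ‖w t‖
      simp only [hΦ]
      linarith
    have h14 := mul_le_mul_of_nonneg_left h13 hκp.le
    linarith
  refine ⟨2 * √(Φ 0), fun t ht => ?_⟩
  have hΦ0 : ∀ t, ‖e t‖ ^ 2 ≤ 4 * Φ t := by
    intro t
    have := (abs_le.1 (hcross t)).1
    have := sq_nonneg ‖w t‖
    simp only [hΦ]
    linarith
  have hΦ0' : 0 ≤ Φ 0 := by linarith [hΦ0 0, sq_nonneg ‖e 0‖]
  have h1 := le_mul_exp_of_hasDerivWithinAt_le hΦ' hdecay ht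
  refine le_of_sq_le_sq ?_ (by positivity)
  rw [mul_pow, mul_pow, Real.sq_sqrt hΦ0', ← Real.exp_nat_mul]
  have h2 : ((2 : ℕ) : ℝ) * (-(κ / 2) * t) = -κ * t := by push_cast; ring
  rw [h2]
  have := hΦ0 t
  change ‖e t‖ ^ 2 ≤ _
  linarith

end PrimalDual

/-! ### The graph Laplacian and the aggregate gradient -/

section Network

variable {N : ℕ} {E : Type*} [NormedAddCommGroup E] [InnerProductSpace ℝ E]

/-- The Laplacian of a weighted graph, acting on tuples of vectors. -/
noncomputable def laplacian (G : WeightedGraph N) (E : Type*) [NormedAddCommGroup E]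
    [InnerProductSpace ℝ E] :
    PiLp 2 (fun _ : Fin N => E) →L[ℝ] PiLp 2 (fun _ : Fin N => E) :=
  (PiLp.continuousLinearEquiv 2 ℝ (fun _ : Fin N => E)).symm.toContinuousLinearMap ∘L
    ContinuousLinearMap.pi fun i => ∑ j, G.a i j • (PiLp.proj 2 (𝕜 := ℝ) (fun _ : Fin N => E) i -
      PiLp.proj 2 (𝕜 := ℝ) (fun _ : Fin N => E) j : PiLp 2 (fun _ : Fin N => E) →L[ℝ] E)

theorem laplacian_apply (G : WeightedGraph N) (x : PiLp 2 (fun _ : Fin N => E)) (i : Fin N) :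
    laplacian G E x i = ∑ j, G.a i j • (x i - x j) := by
  simp [laplacian]

theorem laplacian_const (G : WeightedGraph N) (y : E) :
    laplacian G E (WithLp.toLp 2 fun _ => y) = 0 := by
  refine PiLp.ext fun i => ?_
  rw [laplacian_apply]
  simp

theorem isSymmetric_laplacian (G : WeightedGraph N) :
    (laplacian G E : PiLp 2 (fun _ : Fin N => E) →ₗ[ℝ] _).IsSymmetric := by
  intro x y
  simp only [ContinuousLinearMap.coe_coe, PiLp.inner_apply, laplacian_apply, sum_inner, inner_sum,
    inner_smul_left, inner_smul_right, inner_sub_left, inner_sub_right, mul_sub,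
    Finset.sum_sub_distrib, RCLike.conj_to_real]
  congr 1
  rw [Finset.sum_comm]
  exact Finset.sum_congr rfl fun i _ => Finset.sum_congr rfl fun j _ => by rw [G.symm]

/-- Averaging the double sum with its transpose, by symmetry of the weights, gives the Dirichlet
form. -/
theorem two_mul_inner_laplacian_self (G : WeightedGraph N) (x : PiLp 2 (fun _ : Fin N => E)) :
    2 * inner ℝ (laplacian G E x) x = ∑ i, ∑ j, G.a i j * ‖x i - x j‖ ^ 2 := by
  have h1 : inner ℝ (laplacian G E x) x
      = ∑ i, ∑ j, G.a i j * inner ℝ (x i - x j) (x i) := by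
    simp only [PiLp.inner_apply, laplacian_apply, sum_inner, inner_smul_left, RCLike.conj_to_real]
  have h2 : inner ℝ (laplacian G E x) x
      = ∑ i, ∑ j, G.a i j * inner ℝ (x j - x i) (x j) := by
    rw [h1, Finset.sum_comm]
    exact Finset.sum_congr rfl fun i _ => Finset.sum_congr rfl fun j _ => by rw [G.symm]
  rw [two_mul]
  nth_rw 1 [h1]
  rw [h2]
  simp only [← Finset.sum_add_distrib]
  refine Finset.sum_congr rfl fun i _ => Finset.sum_congr rfl fun j _ => ?_
  rw [← real_inner_self_eq_norm_sq, inner_sub_left (x i), inner_sub_left (x j),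
    inner_sub_right, inner_sub_left, inner_sub_left]
  ring

/-- The Dirichlet form vanishes term by term, so `x` agrees across every edge, hence along every
walk. -/
theorem eq_of_laplacian_eq_zero {G : WeightedGraph N} (hG : G.toSimpleGraph.Connected)
    {x : PiLp 2 (fun _ : Fin N => E)} (hx : laplacian G E x = 0) (i j : Fin N) : x i = x j := by
  have hnn : ∀ i j, 0 ≤ G.a i j * ‖x i - x j‖ ^ 2 := fun i j =>
    mul_nonneg (G.nonneg i j) (sq_nonneg _)
  have h0 := two_mul_inner_laplacian_self G x
  rw [hx, inner_zero_left, mul_zero] at h0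
  have hadj : ∀ i j, G.toSimpleGraph.Adj i j → x i = x j := by
    intro i j hij
    have hij : 0 < G.a i j := hij
    have h1 := (Finset.sum_eq_zero_iff_of_nonneg fun i _ => Finset.sum_nonneg fun j _ => hnn i j).1
      h0.symm i (Finset.mem_univ i)
    have h2 := (Finset.sum_eq_zero_iff_of_nonneg fun j _ => hnn i j).1 h1 j (Finset.mem_univ j)
    rcases mul_eq_zero.1 h2 with h3 | h3
    · exact absurd h3 hij.ne'
    · exact sub_eq_zero.1 (norm_eq_zero.1 (pow_eq_zero_iff two_ne_zero |>.1 h3))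
  obtain ⟨p⟩ := hG.preconnected i j
  induction p with
  | nil => rfl
  | cons h _ ih => exact (hadj _ _ h).trans ih

/-- The gradients of the local costs, as a field on the space of all local estimates. -/
noncomputable def gradientField [CompleteSpace E] (f : Fin N → E → ℝ)
    (x : PiLp 2 (fun _ : Fin N => E)) : PiLp 2 (fun _ : Fin N => E) :=
  WithLp.toLp 2 fun i => gradient (f i) (x i)

variable [CompleteSpace E] {f : Fin N → E → ℝ}

theorem inner_gradientField_sub (x y : PiLp 2 (fun _ : Fin N => E)) :
    inner ℝ (gradientField f x - gradientField f y) (x - y)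
      = ∑ i, inner ℝ (gradient (f i) (x i) - gradient (f i) (y i)) (x i - y i) := by
  simp [PiLp.inner_apply, gradientField]

theorem continuous_gradientField (hf : ∀ i, Differentiable ℝ (f i))
    (hconv : ∀ i, StrictConvexOn ℝ univ (f i)) : Continuous (gradientField f) := by
  refine (PiLp.continuous_toLp 2 _).comp (continuous_pi fun i => ?_)
  exact (continuous_gradient_of_convexOn (hconv i).convexOn (hf i)).comp
    (PiLp.continuous_apply 2 _ i)

theorem inner_gradientField_sub_pos (hf : ∀ i, Differentiable ℝ (f i))
    (hconv : ∀ i, StrictConvexOn ℝ univ (f i)) {x y : PiLp 2 (fun _ : Fin N => E)} (hxy : x ≠ y) :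
    0 < inner ℝ (gradientField f x - gradientField f y) (x - y) := by
  rw [inner_gradientField_sub]
  obtain ⟨i, hi⟩ : ∃ i, x i ≠ y i := by
    by_contra! h
    exact hxy (PiLp.ext h)
  exact Finset.sum_pos' (fun j _ => inner_gradient_sub_nonneg (hconv j).convexOn (hf j) _ _)
    ⟨i, Finset.mem_univ i, inner_gradient_sub_pos (hconv i) (hf i) hi⟩

theorem le_inner_gradientField_sub {ω : ℝ}
    (h : ∀ i p q, ω * ‖p - q‖ ^ 2 ≤ inner ℝ (gradient (f i) p - gradient (f i) q) (p - q))
    (x y : PiLp 2 (fun _ : Fin N => E)) :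
    ω * ‖x - y‖ ^ 2 ≤ inner ℝ (gradientField f x - gradientField f y) (x - y) := by
  rw [inner_gradientField_sub, PiLp.norm_sq_eq_of_L2, Finset.mul_sum]
  exact Finset.sum_le_sum fun i _ => by simpa using h i (x i) (y i)

theorem norm_gradientField_sub_le {ϑ : ℝ≥0} (h : ∀ i, LipschitzWith ϑ (gradient (f i)))
    (x y : PiLp 2 (fun _ : Fin N => E)) :
    ‖gradientField f x - gradientField f y‖ ≤ ϑ * ‖x - y‖ := by
  refine le_of_sq_le_sq ?_ (by positivity)
  rw [mul_pow, PiLp.norm_sq_eq_of_L2, PiLp.norm_sq_eq_of_L2, Finset.mul_sum]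
  refine Finset.sum_le_sum fun i _ => ?_
  rw [← mul_pow]
  gcongr
  exact (h i).norm_sub_le (x i) (y i)

theorem sum_gradient_eq_zero (hf : ∀ i, Differentiable ℝ (f i)) {y : E}
    (hy : IsMinOn (fun y => ∑ i, f i y) univ y) : ∑ i, gradient (f i) y = 0 := by
  have h1 : fderiv ℝ (fun y => ∑ i, f i y) y = 0 :=
    (hy.isLocalMin univ_mem).fderiv_eq_zero
  rw [fderiv_fun_sum fun i _ => hf i y] at h1
  simp only [gradient]
  rw [← map_sum, h1, map_zero]

/-- The optimality conditions have a solution: some dual variable balances the gradients at the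
common minimizer. -/
theorem exists_dual_optimum [FiniteDimensional ℝ E] {G : WeightedGraph N}
    (hG : G.toSimpleGraph.Connected) (hf : ∀ i, Differentiable ℝ (f i)) {y : E}
    (hy : IsMinOn (fun y => ∑ i, f i y) univ y) :
    ∃ q, gradientField f (WithLp.toLp 2 fun _ => y) + laplacian G E q = 0 := by
  set g := gradientField f (WithLp.toLp 2 fun _ => y) with hg
  have hmem : -g ∈ LinearMap.range (laplacian G E : PiLp 2 (fun _ : Fin N => E) →ₗ[ℝ] _) := by
    -- In finite dimension the range of `L` is the orthogonal complement of its kernel. Kernel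
    -- elements are consensus tuples, whose inner product with `g` only involves the sum of the
    -- gradients at `y`, which is zero.
    rw [← Submodule.orthogonal_orthogonal (LinearMap.range _),
      (isSymmetric_laplacian G).orthogonal_range, Submodule.mem_orthogonal]
    intro x hx
    have hx : laplacian G E x = 0 := hx
    obtain ⟨i₀⟩ := hG.nonempty
    rw [inner_neg_right, neg_eq_zero, PiLp.inner_apply]
    have : ∀ i, inner ℝ (x i) (g i) = inner ℝ (x i₀) (gradient (f i) y) := fun i => by
      rw [eq_of_laplacian_eq_zero hG hx i i₀]; rfl
    rw [Finset.sum_congr rfl fun i _ => this i, ← inner_sum, sum_gradient_eq_zero hf hy,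
      inner_zero_right]
  obtain ⟨q, hq⟩ := hmem
  have hq : laplacian G E q = -g := hq
  exact ⟨q, by rw [hq, add_neg_cancel]⟩

end Network

/-! ### The high-gain tracking law -/

section Curves

variable {ι : Type*} [Fintype ι] {E : Type*} [NormedAddCommGroup E] [NormedSpace ℝ E]

theorem hasDerivWithinAt_toLp {φ : ι → ℝ → E} {φ' : ι → E} {s : Set ℝ} {t : ℝ}
    (h : ∀ i, HasDerivWithinAt (φ i) (φ' i) s t) :
    HasDerivWithinAt (fun t => WithLp.toLp 2 fun i => φ i t : ℝ → PiLp 2 fun _ : ι => E)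
      (WithLp.toLp 2 φ') s t :=
  (PiLp.continuousLinearEquiv 2 ℝ (fun _ : ι => E)).symm.hasFDerivAt.comp_hasDerivWithinAt t
    (hasDerivWithinAt_pi.2 h)

theorem hasDerivWithinAt_piLp_apply {φ : ℝ → PiLp 2 fun _ : ι => E} {φ' : PiLp 2 fun _ : ι => E}
    {s : Set ℝ} {t : ℝ} (h : HasDerivWithinAt φ φ' s t) (i : ι) :
    HasDerivWithinAt (fun t => φ t i) (φ' i) s t :=
  (PiLp.proj 2 (𝕜 := ℝ) (fun _ : ι => E) i).hasFDerivAt.comp_hasDerivWithinAt t h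

variable {n m : ℕ}

theorem norm_euclidean_le_sum (v : EuclideanSpace ℝ (Fin m)) : ‖v‖ ≤ ∑ j, |v j| := by
  rw [EuclideanSpace.norm_eq]
  refine Real.sqrt_le_iff.2 ⟨Finset.sum_nonneg fun j _ => abs_nonneg _, ?_⟩
  exact Finset.sum_sq_le_sq_sum_of_nonneg fun j _ => abs_nonneg _

theorem hasDerivWithinAt_timeDeriv {x : ℝ → EuclideanSpace ℝ (Fin m)}
    (hx : ContDiffOn ℝ n x (Ici 0)) {k : ℕ} (hk : k < n) {t : ℝ} (ht : 0 ≤ t) :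
    HasDerivWithinAt (timeDeriv k x) (timeDeriv (k + 1) x t) (Ici 0) t := by
  have h := hx.differentiableOn_iteratedDerivWithin (m := k) (by exact_mod_cast hk)
    (uniqueDiffOn_Ici 0) t ht
  have h2 := h.hasDerivWithinAt
  rw [← iteratedDerivWithin_succ] at h2
  exact h2

theorem timeDeriv_eq_of_hasDerivAt {D : ℕ → ℝ → EuclideanSpace ℝ (Fin m)}
    (hD : ∀ k < n, ∀ t, HasDerivAt (D k) (D (k + 1) t) t) (k : ℕ) (hk : k ≤ n) :
    ∀ t, 0 ≤ t → timeDeriv k (D 0) t = D k t := by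
  induction k with
  | zero => intro t _; simp [timeDeriv]
  | succ k ih =>
    intro t ht
    rw [timeDeriv, iteratedDerivWithin_succ]
    have h1 : HasDerivWithinAt (iteratedDerivWithin k (D 0) (Ici 0)) (D (k + 1) t) (Ici 0) t :=
      (hD k hk t).hasDerivWithinAt.congr (fun s hs => ih (by omega) s hs) (ih (by omega) t ht)
    exact h1.derivWithin (uniqueDiffOn_Ici 0 t ht)

theorem contDiffOn_of_hasDerivAt {D : ℕ → ℝ → EuclideanSpace ℝ (Fin m)}
    (hD : ∀ k < n, ∀ t, HasDerivAt (D k) (D (k + 1) t) t) (hc : Continuous (D n)) :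
    ContDiffOn ℝ n (D 0) (Ici 0) := by
  have hcont : ∀ k ≤ n, Continuous (D k) := fun k hk => by
    rcases hk.lt_or_eq with hk | rfl
    · exact continuous_iff_continuousAt.2 fun t => (hD k hk t).continuousAt
    · exact hc
  refine contDiffOn_of_continuousOn_differentiableOn_deriv (n := (n : ℕ∞))
    (fun k hk => ?_) fun k hk => ?_
  · have hk : k ≤ n := by exact_mod_cast hk
    exact (hcont k hk).continuousOn.congr fun t ht => timeDeriv_eq_of_hasDerivAt hD k hk t ht
  · have hk : k < n := by exact_mod_cast hk
    intro t ht
    exact ((hD k hk t).differentiableAt.differentiableWithinAt).congr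
      (fun s hs => timeDeriv_eq_of_hasDerivAt hD k hk.le s hs)
      (timeDeriv_eq_of_hasDerivAt hD k hk.le t ht)

end Curves

/-! ### The characteristic polynomial of the tracking loop. -/

section CharPoly

open Polynomial

variable {n : ℕ} {c : ℕ → ℝ} {ε : ℝ}

theorem degree_sum_lt (n : ℕ) (c : ℕ → ℝ) :
    (∑ k ∈ Finset.range n, C (c k) * X ^ k : ℝ[X]).degree < n := by
  refine (degree_sum_le _ _).trans_lt ((Finset.sup_lt_iff (WithBot.bot_lt_coe n)).2 fun k hk => ?_)
  exact (degree_C_mul_X_pow_le k (c k)).trans_lt (WithBot.coe_lt_coe.2 (Finset.mem_range.1 hk))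

theorem charPoly_monic (n : ℕ) (c : ℕ → ℝ) : (charPoly n c).Monic := by
  rw [charPoly, add_comm]
  exact monic_X_pow_add (degree_sum_lt n c)

theorem natDegree_charPoly (n : ℕ) (c : ℕ → ℝ) : (charPoly n c).natDegree = n := by
  rw [charPoly, add_comm]
  refine natDegree_eq_of_degree_eq_some ?_
  rw [degree_add_eq_left_of_degree_lt, degree_X_pow]
  rw [degree_X_pow]; exact degree_sum_lt n c

theorem coeff_charPoly {k : ℕ} (hk : k < n) : (charPoly n c).coeff k = c k := by
  simp [charPoly, coeff_X_pow, hk.ne, hk]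

theorem coeff_charPoly_self : (charPoly n c).coeff n = 1 := by
  simp [charPoly, coeff_X_pow]

/-- The coefficients of the characteristic polynomial of the closed tracking loop. -/
noncomputable def scaledCoeff (n : ℕ) (c : ℕ → ℝ) (ε : ℝ) (k : ℕ) : ℝ := ε ^ k * c k / ε ^ n

/-- The scaled polynomial is `p (ε s) / ε ^ n`, so its roots are those of `p` divided by `ε > 0`. -/
theorem isHurwitz_scaled (hc : IsHurwitz (charPoly n c)) (hε : 0 < ε) :
    IsHurwitz (charPoly n (scaledCoeff n c ε)) := by
  intro s hs
  have hε' : (ε : ℂ) ≠ 0 := by exact_mod_cast hε.ne'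
  have h1 : aeval (ε * s : ℂ) (charPoly n c) = 0 := by
    have h2 : aeval (ε * s : ℂ) (charPoly n c)
        = (ε : ℂ) ^ n * aeval s (charPoly n (scaledCoeff n c ε)) := by
      simp only [charPoly, map_add, map_sum, map_mul, map_pow, aeval_X, aeval_C, mul_add,
        Finset.mul_sum, scaledCoeff, Complex.coe_algebraMap, Complex.ofReal_div, Complex.ofReal_mul,
        Complex.ofReal_pow, mul_pow]
      congr 1
      refine Finset.sum_congr rfl fun k _ => ?_
      field_simp
    rw [h2, hs, mul_zero]
  have h3 := hc _ h1
  rw [Complex.re_ofReal_mul] at h3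
  by_contra! h4
  exact absurd h3 (not_lt.2 (mul_nonneg hε.le h4))

/-- The complexified characteristic polynomial of the closed tracking loop. -/
noncomputable def loopPoly (n : ℕ) (c : ℕ → ℝ) (ε : ℝ) : ℂ[X] :=
  (charPoly n (scaledCoeff n c ε)).map (algebraMap ℝ ℂ)

theorem loopPoly_monic : (loopPoly n c ε).Monic := (charPoly_monic _ _).map _

theorem natDegree_loopPoly : (loopPoly n c ε).natDegree = n := by
  rw [loopPoly, natDegree_map, natDegree_charPoly]

theorem re_lt_zero_of_isRoot_loopPoly (hc : IsHurwitz (charPoly n c)) (hε : 0 < ε) {r : ℂ}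
    (hr : (loopPoly n c ε).IsRoot r) : r.re < 0 := by
  refine isHurwitz_scaled hc hε r ?_
  rw [aeval_def, ← eval_map]
  exact hr

/-- There are finitely many roots, all in the open left half-plane. The inequality is strict so that
an input decaying at rate `ρ` does not resonate with a root. -/
theorem exists_decay_rate (hc : IsHurwitz (charPoly n c)) (hε : 0 < ε) :
    ∃ ρ > 0, ∀ r, (loopPoly n c ε).IsRoot r → ρ < -r.re := by
  have h1 : ∀ᶠ ρ in 𝓝[>] (0 : ℝ), ∀ r ∈ (loopPoly n c ε).roots.toFinset, ρ < -r.re := by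
    rw [eventually_all_finset]
    intro r hr
    have hr : (loopPoly n c ε).IsRoot r := (mem_roots'.1 (Multiset.mem_toFinset.1 hr)).2
    have := re_lt_zero_of_isRoot_loopPoly hc hε hr
    exact nhdsWithin_le_nhds (gt_mem_nhds (by linarith))
  obtain ⟨ρ, h2, h3⟩ := (h1.and self_mem_nhdsWithin).exists
  refine ⟨ρ, h3, fun r hr => h2 r ?_⟩
  rw [Multiset.mem_toFinset, mem_roots loopPoly_monic.ne_zero]
  exact hr

/-- The tracking law as a linear differential equation in normal form. -/
theorem sum_coeff_charPoly_eq_iff (hn : 1 ≤ n) (c : ℕ → ℝ) (ε : ℝ) (y : ℕ → ℝ) (ζ : ℝ) :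
    ∑ k ∈ Finset.range (n + 1), (charPoly n (scaledCoeff n c ε)).coeff k * y k
        = scaledCoeff n c ε 0 * ζ ↔
      y n = -(1 / ε ^ n) * (c 0 * (y 0 - ζ) + ∑ k ∈ Finset.Ico 1 n, ε ^ k * c k * y k) := by
  have h1 : ∑ k ∈ Finset.range n, (charPoly n (scaledCoeff n c ε)).coeff k * y k
      = 1 / ε ^ n * (c 0 * y 0 + ∑ k ∈ Finset.Ico 1 n, ε ^ k * c k * y k) := by
    rw [Finset.sum_congr rfl fun k hk => by rw [coeff_charPoly (Finset.mem_range.1 hk)],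
      Finset.range_eq_Ico, Finset.sum_eq_sum_Ico_succ_bot (by omega), mul_add, Finset.mul_sum]
    simp only [scaledCoeff]
    congr 1
    · ring
    · exact Finset.sum_congr rfl fun k _ => by ring
  rw [Finset.sum_range_succ, h1, coeff_charPoly_self, scaledCoeff]
  constructor <;> intro h <;> linear_combination h

end CharPoly

/-! ### Solvability and stability of the tracking loop. -/

section Tracking

variable {n m : ℕ} {c : ℕ → ℝ} {ε : ℝ}

theorem trackingLaw_apply (x z : ℝ → EuclideanSpace ℝ (Fin m)) (t : ℝ) (j : Fin m) :
    trackingLaw n c ε x z t j = -(1 / ε ^ n) * (c 0 * (x t j - z t j)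
      + ∑ k ∈ Finset.Ico 1 n, ε ^ k * c k * timeDeriv k x t j) := by
  simp [trackingLaw]
  ring

/-- The tracking loop has a solution for all initial values and every continuous reference. -/
theorem exists_tracking (hn : 1 ≤ n) (c : ℕ → ℝ) (ε : ℝ) {z : ℝ → EuclideanSpace ℝ (Fin m)}
    (hz : ContinuousOn z (Ici 0)) (x₀ : Fin n → EuclideanSpace ℝ (Fin m)) :
    ∃ x : ℝ → EuclideanSpace ℝ (Fin m), ContDiffOn ℝ n x (Ici 0) ∧
      (∀ t, 0 ≤ t → timeDeriv n x t = trackingLaw n c ε x z t) ∧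
      ∀ k : Fin n, timeDeriv k x 0 = x₀ k := by
  set ζ : ℝ → EuclideanSpace ℝ (Fin m) := fun t => z (max t 0) with hζ
  have hζc : Continuous ζ :=
    hz.comp_continuous (by fun_prop) fun t => mem_Ici.2 (le_max_right _ _)
  have hζj : ∀ j, Continuous fun t => ζ t j := fun j => (PiLp.continuous_apply 2 _ j).comp hζc
  have hex : ∀ j : Fin m, ∃ Y : ℕ → ℝ → ℂ, (∀ k < n, ∀ t, HasDerivAt (Y k) (Y (k + 1) t) t) ∧
      (∀ t, ∑ k ∈ Finset.range (n + 1), (loopPoly n c ε).coeff k * Y k t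
        = ((scaledCoeff n c ε 0 * ζ t j : ℝ) : ℂ)) ∧
      ∀ k < n, Y k 0 = (if h : k < n then (x₀ ⟨k, h⟩ j : ℂ) else 0) := fun j =>
    exists_cascade n (loopPoly n c ε) loopPoly_monic natDegree_loopPoly _ _
      (Complex.continuous_ofReal.comp (continuous_const.mul (hζj j)))
  choose Y hY hYeq hY0 using hex
  -- The equation has real coefficients and real input, so real parts of complex solutions are again
  -- solutions.
  set D : ℕ → ℝ → EuclideanSpace ℝ (Fin m) := fun k t => WithLp.toLp 2 fun j => (Y j k t).re
    with hD
  have hDeriv : ∀ k < n, ∀ t, HasDerivAt (D k) (D (k + 1) t) t := fun k hk t => by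
    rw [← hasDerivWithinAt_univ]
    refine hasDerivWithinAt_toLp fun j => ?_
    rw [hasDerivWithinAt_univ]
    exact Complex.reCLM.hasFDerivAt.comp_hasDerivAt t (hY j k hk t)
  have hlaw : ∀ t j, D n t j = -(1 / ε ^ n) * (c 0 * (D 0 t j - ζ t j)
      + ∑ k ∈ Finset.Ico 1 n, ε ^ k * c k * D k t j) := fun t j => by
    refine (sum_coeff_charPoly_eq_iff hn c ε (fun k => D k t j) (ζ t j)).1 ?_
    have := congrArg Complex.re (hYeq j t)
    simpa [loopPoly, Polynomial.coeff_map] using this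
  have hDc : ∀ k < n, ∀ j, Continuous fun t => D k t j := fun k hk j =>
    (PiLp.continuous_apply 2 _ j).comp
      (continuous_iff_continuousAt.2 fun t => (hDeriv k hk t).continuousAt)
  have hDn : Continuous (D n) := by
    have : D n = fun t => WithLp.toLp 2 fun j => D n t j := rfl
    rw [this]
    refine (PiLp.continuous_toLp 2 _).comp (continuous_pi fun j => ?_)
    simp only [hlaw]
    refine continuous_const.mul ((continuous_const.mul ((hDc 0 hn j).sub (hζj j))).add
      (continuous_finsetSum _ fun k hk => continuous_const.mul (hDc k ?_ j)))
    exact (Finset.mem_Ico.1 hk).2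
  have htd := timeDeriv_eq_of_hasDerivAt hDeriv
  refine ⟨D 0, contDiffOn_of_hasDerivAt hDeriv hDn, fun t ht => ?_, fun k => ?_⟩
  · refine PiLp.ext fun j => ?_
    rw [htd n le_rfl t ht, trackingLaw_apply, hlaw, hζ]
    simp only [max_eq_left ht]
    congr 2
    refine Finset.sum_congr rfl fun k hk => ?_
    rw [htd k (Finset.mem_Ico.1 hk).2.le t ht]
  · refine PiLp.ext fun j => ?_
    rw [htd k k.2.le 0 le_rfl]
    have := congrArg Complex.re (hY0 j k k.2)
    simpa [hD] using this

/-- Stability properties pass from the reference error to the tracking error. -/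
theorem tracking_mem (hn : 1 ≤ n) (S : Submodule ℂ (ℝ → ℂ))
    (hS : ∀ r, (loopPoly n c ε).IsRoot r → ∀ w g : ℝ → ℂ,
      (∀ t, 0 ≤ t → HasDerivWithinAt w (r * w t + g t) (Ici 0) t) → g ∈ S → w ∈ S)
    {x z : ℝ → EuclideanSpace ℝ (Fin m)} (hx : ContDiffOn ℝ n x (Ici 0))
    (hlaw : ∀ t, 0 ≤ t → timeDeriv n x t = trackingLaw n c ε x z t)
    (p : EuclideanSpace ℝ (Fin m)) (j : Fin m)
    (hz : (fun t => ((z t j - p j : ℝ) : ℂ)) ∈ S) {k : ℕ} (hk : k < n) :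
    (fun t => ((timeDeriv k x t j - if k = 0 then p j else 0 : ℝ) : ℂ)) ∈ S := by
  -- The constant curve `p` solves the loop with reference `p`, so by linearity the error solves it
  -- with reference `z - p`; the `if` term is the `k`-th derivative of that constant.
  refine cascade_mem S n (loopPoly n c ε) loopPoly_monic natDegree_loopPoly hS
    (fun k t => ((timeDeriv k x t j - if k = 0 then p j else 0 : ℝ) : ℂ))
    (fun t => (scaledCoeff n c ε 0 : ℂ) * ((z t j - p j : ℝ) : ℂ)) (fun k hk t ht => ?_)
    (fun t ht => ?_) (S.smul_mem (scaledCoeff n c ε 0 : ℂ) hz) k hk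
  · have h1 := (hasDerivWithinAt_piLp_apply (hasDerivWithinAt_timeDeriv hx hk ht) j).sub_const
      (if k = 0 then p j else 0)
    have h2 := Complex.ofRealCLM.hasFDerivAt.comp_hasDerivWithinAt t h1
    exact h2.congr_deriv (by simp)
  · have h1 := congrFun (congrArg WithLp.ofLp (hlaw t ht)) j
    rw [trackingLaw_apply] at h1
    have h2 := (sum_coeff_charPoly_eq_iff hn c ε
      (fun k => timeDeriv k x t j - if k = 0 then p j else 0) (z t j - p j)).2 (by
        have h0 : timeDeriv 0 x t j = x t j := by simp [timeDeriv]
        have h3 : ∑ k ∈ Finset.Ico 1 n, ε ^ k * c k * (timeDeriv k x t j - if k = 0 then p j else 0)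
            = ∑ k ∈ Finset.Ico 1 n, ε ^ k * c k * timeDeriv k x t j :=
          Finset.sum_congr rfl fun k hk => by
            rw [if_neg (by have := (Finset.mem_Ico.1 hk).1; omega), sub_zero]
        simp only [h3, ↓reduceIte]
        rw [if_neg (by omega), sub_zero, h1, h0]
        ring)
    have h4 := congrArg Complex.ofReal h2
    simp only [Complex.ofReal_sum, Complex.ofReal_mul] at h4
    simp only [loopPoly, Polynomial.coeff_map, Complex.coe_algebraMap]
    exact h4

theorem tracking_expDecaying (hn : 1 ≤ n) {γ K : ℝ}
    (hγ : ∀ r, (loopPoly n c ε).IsRoot r → γ < -r.re)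
    {x z : ℝ → EuclideanSpace ℝ (Fin m)} (hx : ContDiffOn ℝ n x (Ici 0))
    (hlaw : ∀ t, 0 ≤ t → timeDeriv n x t = trackingLaw n c ε x z t)
    {p : EuclideanSpace ℝ (Fin m)} (hz : ∀ t, 0 ≤ t → ‖z t - p‖ ≤ K * Real.exp (-γ * t))
    {k : ℕ} (hk : k < n) :
    ∃ K', ∀ t, 0 ≤ t → ‖timeDeriv k x t - if k = 0 then p else 0‖ ≤ K' * Real.exp (-γ * t) := by
  have hmem : ∀ j, (fun t => ((timeDeriv k x t j - if k = 0 then p j else 0 : ℝ) : ℂ))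
      ∈ expDecaying γ := fun j =>
    tracking_mem hn (expDecaying γ)
      (fun r hr w g hw hg => first_order_mem_expDecaying (hγ r hr) hw hg) hx hlaw p j
      ⟨K, fun t ht => by
        rw [Complex.norm_real]
        exact (PiLp.norm_apply_le (z t - p) j).trans (hz t ht)⟩ hk
  choose K' hK' using hmem
  refine ⟨∑ j, K' j, fun t ht => (norm_euclidean_le_sum _).trans ?_⟩
  rw [Finset.sum_mul]
  refine Finset.sum_le_sum fun j _ => ?_
  have h1 := hK' j t ht
  rw [Complex.norm_real, Real.norm_eq_abs] at h1
  have h2 : (timeDeriv k x t - if k = 0 then p else 0) j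
      = timeDeriv k x t j - if k = 0 then p j else 0 := by
    split_ifs <;> simp
  rw [h2]
  exact h1

theorem tracking_tendsto (hn : 1 ≤ n)
    (hroot : ∀ r, (loopPoly n c ε).IsRoot r → r.re < 0)
    {x z : ℝ → EuclideanSpace ℝ (Fin m)} (hx : ContDiffOn ℝ n x (Ici 0))
    (hlaw : ∀ t, 0 ≤ t → timeDeriv n x t = trackingLaw n c ε x z t)
    {p : EuclideanSpace ℝ (Fin m)} (hz : Tendsto z atTop (𝓝 p)) : Tendsto x atTop (𝓝 p) := by
  have hxj : ∀ j, Tendsto (fun t => x t j) atTop (𝓝 (p j)) := fun j => by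
    have h1 : (fun t => ((z t j - p j : ℝ) : ℂ)) ∈ vanishing := by
      have := (Complex.continuous_ofReal.tendsto _).comp
        ((((PiLp.continuous_apply 2 _ j).tendsto p).comp hz).sub_const (p j))
      rw [sub_self, Complex.ofReal_zero] at this
      exact this
    have h2 := tracking_mem hn vanishing
      (fun r hr w g hw hg => first_order_mem_vanishing (hroot r hr) hw hg) hx hlaw p j h1
      (k := 0) (by omega)
    change Tendsto (fun t => ((timeDeriv 0 x t j - if 0 = 0 then p j else 0 : ℝ) : ℂ)) atTop (𝓝 0)
      at h2
    have h3 := ((Complex.continuous_re.tendsto _).comp h2).add_const (p j)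
    simpa [timeDeriv, Function.comp_def] using h3
  exact ((PiLp.continuous_toLp 2 _).tendsto _).comp (tendsto_pi_nhds.2 hxj)

end Tracking

/-! ### The closed loop -/

section ClosedLoop

variable {N m n : ℕ} {G : WeightedGraph N} {f : Fin N → EuclideanSpace ℝ (Fin m) → ℝ}
  {c : ℕ → ℝ} {ε : ℝ} {x z l : Fin N → ℝ → EuclideanSpace ℝ (Fin m)}
  {y : EuclideanSpace ℝ (Fin m)}

theorem norm_sub_le_norm_toLp_sub {E : Type*} [NormedAddCommGroup E] (u : Fin N → E)
    (v : PiLp 2 fun _ : Fin N => E) (i : Fin N) : ‖u i - v i‖ ≤ ‖WithLp.toLp 2 u - v‖ :=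
  PiLp.norm_apply_le (WithLp.toLp 2 u - v) i

theorem IsClosedLoopTrajectory.isPrimalDualTrajectory
    (h : IsClosedLoopTrajectory n G f c ε x z l) :
    IsPrimalDualTrajectory (gradientField f) (laplacian G (EuclideanSpace ℝ (Fin m)))
      (fun t => WithLp.toLp 2 fun i => z i t) (fun t => WithLp.toLp 2 fun i => l i t) where
  primal t ht := (hasDerivWithinAt_toLp fun i => h.primal i t ht).congr_deriv <|
    PiLp.ext fun i => by simp [laplacian_apply, gradientField]
  dual t ht := (hasDerivWithinAt_toLp fun i => h.dual i t ht).congr_deriv <|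
    PiLp.ext fun i => by simp [laplacian_apply]

theorem exists_closedLoop (hn : 1 ≤ n) (hG : G.toSimpleGraph.Connected)
    (hf : ∀ i, Differentiable ℝ (f i)) (hconv : ∀ i, StrictConvexOn ℝ univ (f i))
    (hy : IsMinOn (fun y => ∑ i, f i y) univ y) (c : ℕ → ℝ) (ε : ℝ)
    (x₀ : Fin N → Fin n → EuclideanSpace ℝ (Fin m))
    (z₀ l₀ : Fin N → EuclideanSpace ℝ (Fin m)) :
    ∃ x z l : Fin N → ℝ → EuclideanSpace ℝ (Fin m), IsClosedLoopTrajectory n G f c ε x z l ∧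
      ∀ i, (∀ k : Fin n, timeDeriv (k : ℕ) (x i) 0 = x₀ i k) ∧ z i 0 = z₀ i ∧ l i 0 = l₀ i := by
  obtain ⟨q, hq⟩ := exists_dual_optimum hG hf hy
  obtain ⟨Z, Λ, hZ, hZ0, hΛ0⟩ := exists_primalDual (isSymmetric_laplacian G)
    (continuous_gradientField hf hconv)
    (fun v w => by
      rcases eq_or_ne v w with rfl | hvw
      · simp
      · exact (inner_gradientField_sub_pos hf hconv hvw).le)
    (laplacian_const G y) hq (WithLp.toLp 2 z₀) (WithLp.toLp 2 l₀)
  have hz : ∀ i t, 0 ≤ t → HasDerivWithinAt (fun t => Z t i)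
      (-gradient (f i) (Z t i) - ∑ j, G.a i j • (Λ t i - Λ t j)) (Ici 0) t := fun i t ht =>
    (hasDerivWithinAt_piLp_apply (hZ.primal t ht) i).congr_deriv
      (by simp [laplacian_apply, gradientField])
  choose x hx hlaw hx0 using fun i => exists_tracking (z := fun t => Z t i) hn c ε
    (fun t ht => (hz i t ht).continuousWithinAt) (x₀ i)
  refine ⟨x, fun i t => Z t i, fun i t => Λ t i, ⟨hx, hlaw, hz, fun i t ht => ?_⟩,
    fun i => ⟨hx0 i, by simp [hZ0], by simp [hΛ0]⟩⟩
  exact (hasDerivWithinAt_piLp_apply (hZ.dual t ht) i).congr_deriv (laplacian_apply G _ i)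

theorem IsClosedLoopTrajectory.exists_norm_le (hn : 1 ≤ n) (hG : G.toSimpleGraph.Connected)
    (hf : ∀ i, Differentiable ℝ (f i)) (hconv : ∀ i, StrictConvexOn ℝ univ (f i))
    (hy : IsMinOn (fun y => ∑ i, f i y) univ y) (hc : IsHurwitz (charPoly n c)) (hε : 0 < ε)
    (h : IsClosedLoopTrajectory n G f c ε x z l) :
    ∃ M : ℝ, ∀ i, ∀ t, 0 ≤ t →
      (∀ k < n, ‖timeDeriv k (x i) t‖ ≤ M) ∧ ‖z i t‖ ≤ M ∧ ‖l i t‖ ≤ M := by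
  obtain ⟨q, hq⟩ := exists_dual_optimum hG hf hy
  obtain ⟨R, hR⟩ := h.isPrimalDualTrajectory.exists_norm_le (isSymmetric_laplacian G)
    (fun v w => by
      rcases eq_or_ne v w with rfl | hvw
      · simp
      · exact (inner_gradientField_sub_pos hf hconv hvw).le)
    (laplacian_const G y) hq
  have hzR : ∀ i t, 0 ≤ t → ‖z i t - y‖ ≤ R := fun i t ht =>
    (norm_sub_le_norm_toLp_sub (fun i => z i t) (WithLp.toLp 2 fun _ => y) i).trans (hR t ht).1
  have hlR : ∀ i t, 0 ≤ t → ‖l i t - q i‖ ≤ R := fun i t ht =>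
    (norm_sub_le_norm_toLp_sub (fun i => l i t) q i).trans (hR t ht).2
  have hx : ∀ i, ∀ k : Fin n, ∃ K, ∀ t, 0 ≤ t → ‖timeDeriv k (x i) t‖ ≤ K := by
    intro i k
    -- At rate `0` exponential decay is just boundedness.
    obtain ⟨K, hK⟩ := tracking_expDecaying hn (γ := 0)
      (fun r hr => by linarith [re_lt_zero_of_isRoot_loopPoly hc hε hr]) (h.contDiffOn i)
      (h.agent i) (p := y) (K := R) (fun t ht => by simpa using hzR i t ht) k.2
    set a : EuclideanSpace ℝ (Fin m) := if (k : ℕ) = 0 then y else 0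
    refine ⟨K + ‖a‖, fun t ht => ?_⟩
    have h1 := norm_add_le (timeDeriv k (x i) t - a) a
    rw [sub_add_cancel] at h1
    have h2 := hK t ht
    simp only [neg_zero, zero_mul, Real.exp_zero, mul_one] at h2
    linarith
  choose K hK using hx
  obtain ⟨M, hM⟩ := (Set.finite_range fun ik : Fin N × Fin n => K ik.1 ik.2).bddAbove
  obtain ⟨Q, hQ⟩ := (Set.finite_range fun i : Fin N => ‖q i‖).bddAbove
  refine ⟨max M (max (R + ‖y‖) (R + Q)), fun i t ht => ⟨fun k hk => ?_, ?_, ?_⟩⟩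
  · exact (hK i ⟨k, hk⟩ t ht).trans ((hM ⟨(i, ⟨k, hk⟩), rfl⟩).trans (le_max_left _ _))
  · refine le_trans ?_ ((le_max_left _ _).trans (le_max_right _ _))
    have h1 := norm_add_le (z i t - y) y
    rw [sub_add_cancel] at h1
    linarith [hzR i t ht]
  · refine le_trans ?_ ((le_max_right _ _).trans (le_max_right _ _))
    have h1 := norm_add_le (l i t - q i) (q i)
    rw [sub_add_cancel] at h1
    linarith [hlR i t ht, hQ ⟨i, rfl⟩]

theorem IsClosedLoopTrajectory.tendsto (hn : 1 ≤ n) (hG : G.toSimpleGraph.Connected)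
    (hf : ∀ i, Differentiable ℝ (f i)) (hconv : ∀ i, StrictConvexOn ℝ univ (f i))
    (hy : IsMinOn (fun y => ∑ i, f i y) univ y) (hc : IsHurwitz (charPoly n c)) (hε : 0 < ε)
    (h : IsClosedLoopTrajectory n G f c ε x z l) (i : Fin N) :
    Tendsto (x i) atTop (𝓝 y) := by
  obtain ⟨q, hq⟩ := exists_dual_optimum hG hf hy
  have hz := h.isPrimalDualTrajectory.tendsto (isSymmetric_laplacian G)
    (continuous_gradientField hf hconv) (fun v w => inner_gradientField_sub_pos hf hconv)
    (laplacian_const G y) hq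
  exact tracking_tendsto hn (fun r hr => re_lt_zero_of_isRoot_loopPoly hc hε hr) (h.contDiffOn i)
    (h.agent i) (((PiLp.continuous_apply 2 (fun _ : Fin N => EuclideanSpace ℝ (Fin m)) i).tendsto
      _).comp hz)

/-- The rate is the smaller of the generator's rate and the stability margin of the tracking loop,
neither of which depends on the trajectory. -/
theorem exists_rate_closedLoop (hn : 1 ≤ n) (hG : G.toSimpleGraph.Connected)
    (hf : ∀ i, Differentiable ℝ (f i))
    (hy : IsMinOn (fun y => ∑ i, f i y) univ y) (hc : IsHurwitz (charPoly n c)) (hε : 0 < ε)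
    {ω : ℝ} {ϑ : ℝ≥0} (hω : 0 < ω) (hstrong : ∀ i, IsStronglyConvex ω (f i))
    (hlip : ∀ i, LipschitzWith ϑ (gradient (f i))) :
    ∃ γ : ℝ, 0 < γ ∧ ∀ x z l : Fin N → ℝ → EuclideanSpace ℝ (Fin m),
      IsClosedLoopTrajectory n G f c ε x z l →
        ∃ K : ℝ, ∀ i, ∀ t, 0 ≤ t → ‖x i t - y‖ ≤ K * Real.exp (-γ * t) := by
  obtain ⟨q, hq⟩ := exists_dual_optimum hG hf hy
  have hstrong' := le_inner_gradientField_sub (fun i p q => hstrong i p q)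
  have hlip' := norm_gradientField_sub_le hlip
  obtain ⟨γ₀, hγ₀, hrate⟩ := exists_rate_primalDual hω (isSymmetric_laplacian G)
    hstrong' hlip' (laplacian_const G y) hq
  obtain ⟨ρ, hρ, hroot⟩ := exists_decay_rate hc hε
  refine ⟨min γ₀ ρ, lt_min hγ₀ hρ, fun x z l h => ?_⟩
  obtain ⟨K, hK⟩ := hrate _ _ h.isPrimalDualTrajectory
  have hK0 : 0 ≤ K := by simpa using (norm_nonneg _).trans (hK 0 le_rfl)
  have hz : ∀ i t, 0 ≤ t → ‖z i t - y‖ ≤ K * Real.exp (-(min γ₀ ρ) * t) := fun i t ht => by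
    refine (norm_sub_le_norm_toLp_sub (fun i => z i t) (WithLp.toLp 2 fun _ => y) i).trans
      ((hK t ht).trans ?_)
    gcongr
    exact min_le_left _ _
  have hx : ∀ i, ∃ K, ∀ t, 0 ≤ t → ‖x i t - y‖ ≤ K * Real.exp (-(min γ₀ ρ) * t) := fun i => by
    have h1 := tracking_expDecaying hn
      (fun r hr => (min_le_right γ₀ ρ).trans_lt (hroot r hr)) (h.contDiffOn i) (h.agent i) (hz i)
      (k := 0) (by omega)
    simpa [timeDeriv] using h1
  choose L hL using hx
  obtain ⟨M, hM⟩ := (Set.finite_range L).bddAbove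
  exact ⟨M, fun i t ht => (hL i t ht).trans
    (mul_le_mul_of_nonneg_right (hM (mem_range_self i)) (Real.exp_nonneg _))⟩

end ClosedLoop

end OptConsensus

theorem mainTheorem6 {N m n : ℕ} (hn : 1 ≤ n)
    (G : OptConsensus.WeightedGraph N) (hG : G.toSimpleGraph.Connected)
    (f : Fin N → EuclideanSpace ℝ (Fin m) → ℝ)
    (hf : ∀ i, Differentiable ℝ (f i))
    (hconv : ∀ i, StrictConvexOn ℝ univ (f i))
    (ystar : EuclideanSpace ℝ (Fin m))
    (hstar : IsMinOn (fun y => ∑ i, f i y) univ ystar)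
    (c : ℕ → ℝ) (hc : OptConsensus.IsHurwitz (OptConsensus.charPoly n c))
    (ε : ℝ) (hε : 0 < ε) :
    -- every initial condition gives rise to a trajectory on `[0, ∞)`
    (∀ (x₀ : Fin N → Fin n → EuclideanSpace ℝ (Fin m))
        (z₀ l₀ : Fin N → EuclideanSpace ℝ (Fin m)),
      ∃ x z l : Fin N → ℝ → EuclideanSpace ℝ (Fin m),
        OptConsensus.IsClosedLoopTrajectory n G f c ε x z l ∧
        ∀ i, (∀ k : Fin n, OptConsensus.timeDeriv (k : ℕ) (x i) 0 = x₀ i k) ∧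
          z i 0 = z₀ i ∧ l i 0 = l₀ i) ∧
    -- every trajectory is bounded and every output converges to the optimal solution
    (∀ x z l : Fin N → ℝ → EuclideanSpace ℝ (Fin m),
      OptConsensus.IsClosedLoopTrajectory n G f c ε x z l →
        (∃ M : ℝ, ∀ i, ∀ t, 0 ≤ t →
          (∀ k < n, ‖OptConsensus.timeDeriv k (x i) t‖ ≤ M) ∧ ‖z i t‖ ≤ M ∧ ‖l i t‖ ≤ M) ∧
        ∀ i, Tendsto (fun t => ‖x i t - ystar‖) atTop (𝓝 0)) ∧
    -- exponential convergence in the strongly convex case, with a rate common to all trajectories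
    (∀ (ω : ℝ) (ϑ : ℝ≥0), 0 < ω → 0 < ϑ →
      (∀ i, OptConsensus.IsStronglyConvex ω (f i)) →
      (∀ i, LipschitzWith ϑ (gradient (f i))) →
        ∃ γ : ℝ, 0 < γ ∧ ∀ x z l : Fin N → ℝ → EuclideanSpace ℝ (Fin m),
          OptConsensus.IsClosedLoopTrajectory n G f c ε x z l →
            ∃ K : ℝ, ∀ i, ∀ t, 0 ≤ t → ‖x i t - ystar‖ ≤ K * Real.exp (-γ * t)) := by
  refine ⟨OptConsensus.exists_closedLoop hn hG hf hconv hstar c ε, fun x z l h => ⟨?_, fun i => ?_⟩,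
    fun ω ϑ hω _ hstrong hlip =>
      OptConsensus.exists_rate_closedLoop hn hG hf hstar hc hε hω hstrong hlip⟩
  · exact h.exists_norm_le hn hG hf hconv hstar hc hε
  · exact tendsto_iff_norm_sub_tendsto_zero.1 (h.tendsto hn hG hf hconv hstar hc hε i)
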